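/- **Setting.** Let $I=(a,b)$ with $-\infty\le a<b\le\infty$, let $m\ge 0$ and let $q_{\rm sc},q_{\rm el},q_{\rm am}\in L^1_{loc}(I)$ be real-valued. With the Pauli matrices $\sigma_1,\sigma_2,\sigma_3$ put $$\tau=\frac1{\mathrm i}\sigma_2\frac{d}{dx}+Q(x),\qquad Q=q_{\rm el}\,\mathbb 1+q_{\rm am}\sigma_1+(m+q_{\rm sc})\sigma_3,$$ let $W_x(f,g)=f_1(x)g_2(x)-f_2(x)g_1(x)$, and let $W_a,W_b$ denote its limits as $x\to a$, $x\to b$. Solutions of $\tau u=zu$ are functions $u\in AC_{loc}(I,\mathbb C^2)$ satisfying the equation almost everywhere on $I$. We say that $\tau$ is limit circle at $b$ if for every $z\in\mathbb C$ all solutions of $\tau u=zu$ are square integrable near $b$, and limit point at $b$ otherwise. For a point $c\in I$ let $c(z,x)$, $s(z,x)$ be the solutions of $\tau u=zu$ with $c(z,c)=(1,0)^T$, $s(z,c)=(0,1)^T$. **Hypothesis.** Fix $\lambda_0\in\mathbb R$ and let $\Phi_0,\Theta_0$ be real-valued solutions of $\tau u=\lambda_0u$ with $W(\Theta_0,\Phi_0)=1$,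 such that the limits $\lim_{x\to a}W_x(\Phi_0,u)$ and $\lim_{x\to a}W_x(\Theta_0,u)$ exist for every $z\in\mathbb C$ and every solution $u$ of $\tau u=zu$ (that is, $\tau$ is limit circle at $a$). Let $u_+$ be a nontrivial solution of $\tau u=0$ if $\tau$ is limit circle at $b$, and $u_+=0$ if $\tau$ is limit point at $b$, and suppose that the operator $Hf=\tau f$ in $L^2(I,\mathbb C^2)$ with domain $$\mathfrak D(H)=\{f\in L^2(I,\mathbb C^2)\cap AC_{loc}(I,\mathbb C^2)\;:\;\tau f\in L^2(I,\mathbb C^2),\ W_a(\Phi_0,f)=W_b(u_+,f)=0\}$$ is self-adjoint. Set $$\Phi(z,x)=W_a(c(z),\Phi_0)s(z,x)-W_a(s(z),\Phi_0)c(z,x),\qquad \Theta(z,x)=W_a(c(z),\Theta_0)s(z,x)-W_a(s(z),\Theta_0)c(z,x).$$ **Theorem 4.2.** For every $z\in\mathbb C\setminus\mathbb R$ there is exactly one number $M(z)\in\mathbb C$ such that $$\Psi(z,x)=\Theta(z,x)+M(z)\Phi(z,x)$$ is square integrable near $b$ and satisfies $W_b(u_+,\Psi(z))=0$. The function $M$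 so defined (the singular Weyl function) is a Herglotz–Nevanlinna function: it is holomorphic on $\mathbb C\setminus\mathbb R$, satisfies $M(z^*)=M(z)^*$ there, and $\operatorname{Im}M(z)\ge 0$ for $\operatorname{Im}z>0$. Moreover, $\Psi(z,\cdot)\in L^2(I,\mathbb C^2)$ and $$\operatorname{Im}M(z)=\operatorname{Im}z\int_a^b|\Psi(z,x)|^2\,dx ,\qquad z\in\mathbb C\setminus\mathbb R.$$ The last two claims hold in the same way at every real $z$ at which $M(z)$ is a complex number such that $\Psi(z,x)=\Theta(z,x)+M(z)\Phi(z,x)$ is square integrable near $b$ with $W_b(u_+,\Psi(z))=0$. -/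

import Mathlib

open MeasureTheory Filter Topology

noncomputable section

/-- `ℂ²` with its Euclidean norm. -/
abbrev C2 : Type := EuclideanSpace ℂ (Fin 2)

/-- The Pauli matrices. -/
def pauli1 : Matrix (Fin 2) (Fin 2) ℂ := !![0, 1; 1, 0]
def pauli2 : Matrix (Fin 2) (Fin 2) ℂ := !![0, -Complex.I; Complex.I, 0]
def pauli3 : Matrix (Fin 2) (Fin 2) ℂ := !![1, 0; 0, -1]

/-- The coefficients of a one-dimensional Dirac expression on `(a,b)`, `-∞ ≤ a < b ≤ ∞`:
a mass and real, locally integrable scalar, electrostatic and anomalous magnetic potentials. -/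
structure DiracExpr where
  a : EReal
  b : EReal
  a_lt_b : a < b
  mass : ℝ
  mass_nonneg : 0 ≤ mass
  qsc : ℝ → ℝ
  qel : ℝ → ℝ
  qam : ℝ → ℝ
  qsc_loc : LocallyIntegrableOn qsc {x : ℝ | a < (x : EReal) ∧ (x : EReal) < b} volume
  qel_loc : LocallyIntegrableOn qel {x : ℝ | a < (x : EReal) ∧ (x : EReal) < b} volume
  qam_loc : LocallyIntegrableOn qam {x : ℝ | a < (x : EReal) ∧ (x : EReal) < b} volume

/-- The Wronskian `W_x(f,g) = f₁(x) g₂(x) - f₂(x) g₁(x)`. -/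
def wronskian (f g : ℝ → C2) (x : ℝ) : ℂ := f x 0 * g x 1 - f x 1 * g x 0

/-- Herglotz--Nevanlinna functions, as functions on `ℂ \ ℝ`: holomorphic there, compatible with
complex conjugation, and with nonnegative imaginary part on the upper half-plane. -/
def IsHerglotzNevanlinna (M : ℂ → ℂ) : Prop :=
  DifferentiableOn ℂ M {z : ℂ | z.im ≠ 0} ∧
  (∀ z : ℂ, z.im ≠ 0 → M (starRingEnd ℂ z) = starRingEnd ℂ (M z)) ∧
  ∀ z : ℂ, 0 < z.im → 0 ≤ (M z).im

namespace DiracExpr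

/-- The interval `I = (a,b)` as a set of real numbers. -/
def I (D : DiracExpr) : Set ℝ := {x : ℝ | D.a < (x : EReal) ∧ (x : EReal) < D.b}

/-- Lebesgue measure on `I`. -/
def vol (D : DiracExpr) : Measure ℝ := volume.restrict D.I

/-- The filter of real `x → a`, `x > a` (`x → -∞` if `a = -∞`). -/
def atA (D : DiracExpr) : Filter ℝ := comap (fun x : ℝ => (x : EReal)) (𝓝[>] D.a)

/-- The filter of real `x → b`, `x < b` (`x → ∞` if `b = ∞`). -/
def atB (D : DiracExpr) : Filter ℝ := comap (fun x : ℝ => (x : EReal)) (𝓝[<] D.b)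

/-- The potential matrix `Q = q_el 1 + q_am σ₁ + (m + q_sc) σ₃`. -/
def Q (D : DiracExpr) (x : ℝ) : Matrix (Fin 2) (Fin 2) ℂ :=
  ((D.qel x : ℝ) : ℂ) • (1 : Matrix (Fin 2) (Fin 2) ℂ) + ((D.qam x : ℝ) : ℂ) • pauli1 +
    ((D.mass + D.qsc x : ℝ) : ℂ) • pauli3

/-- The differential expression `τ u = (1/i) σ₂ u' + Q u`. -/
def tau (D : DiracExpr) (u : ℝ → C2) (x : ℝ) : C2 :=
  WithLp.toLp 2 (((1 / Complex.I) • pauli2).mulVec (WithLp.ofLp (deriv u x)) +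
    (D.Q x).mulVec (WithLp.ofLp (u x)))

/-- `u ∈ AC_loc(I, ℂ²)`. -/
def ACloc (D : DiracExpr) (u : ℝ → C2) : Prop :=
  ∀ s ∈ D.I, ∀ t ∈ D.I, AbsolutelyContinuousOnInterval u s t

/-- `u` is a solution of `τ u = z u` on `I`. -/
def IsSolution (D : DiracExpr) (z : ℂ) (u : ℝ → C2) : Prop :=
  D.ACloc u ∧ ∀ᵐ x ∂D.vol, D.tau u x = z • u x

/-- `u` is real-valued on `I`. -/
def IsRealValued (D : DiracExpr) (u : ℝ → C2) : Prop :=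
  ∀ x ∈ D.I, ∀ i : Fin 2, (u x i).im = 0

/-- `u` is square integrable near the endpoint `b`. -/
def L2NearB (D : DiracExpr) (u : ℝ → C2) : Prop :=
  ∀ c ∈ D.I, MemLp u 2 (volume.restrict {x : ℝ | c < x ∧ (x : EReal) < D.b})

/-- `τ` is in the limit circle case at `b`: all solutions of `τ u = z u` are square integrable
near `b`. Otherwise `τ` is in the limit point case at `b`. -/
def IsLimitCircleAtB (D : DiracExpr) : Prop :=
  ∀ (z : ℂ) (u : ℝ → C2), D.IsSolution z u → D.L2NearB u

/-- `uplus` is admissible for generating the boundary condition at `b`: a nontrivial solution of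
`τ u = 0` in the limit circle case, and zero in the limit point case. -/
def IsBoundaryFunctionAtB (D : DiracExpr) (uplus : ℝ → C2) : Prop :=
  (D.IsLimitCircleAtB → D.IsSolution 0 uplus ∧ ∃ x ∈ D.I, uplus x ≠ 0) ∧
  (¬ D.IsLimitCircleAtB → ∀ x ∈ D.I, uplus x = 0)

/-- The Hilbert space `L²(I, ℂ²)`. -/
abbrev L2 (D : DiracExpr) : Type := Lp C2 2 D.vol

theorem ACloc.ae_differentiableAt {D : DiracExpr} {u : ℝ → C2} (hu : D.ACloc u) :
    ∀ᵐ x ∂D.vol, DifferentiableAt ℝ u x := by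
  have hI : MeasurableSet D.I :=
    (measurableSet_lt measurable_const measurable_coe_real_ereal).inter
      (measurableSet_lt measurable_coe_real_ereal measurable_const)
  rw [vol, ae_restrict_iff' hI]
  have h : ∀ᵐ x : ℝ, ∀ p q : ℚ, (p : ℝ) ∈ D.I → (q : ℝ) ∈ D.I →
      x ∈ Set.uIcc (p : ℝ) q → DifferentiableAt ℝ u x := by
    refine ae_all_iff.2 fun p => ae_all_iff.2 fun q => ?_
    by_cases hp : (p : ℝ) ∈ D.I
    · by_cases hq : (q : ℝ) ∈ D.I
      · filter_upwards [(hu p hp q hq).boundedVariationOn.ae_differentiableAt_of_mem_uIcc]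
          with x hx _ _ using hx
      · exact ae_of_all _ fun x _ h => absurd h hq
    · exact ae_of_all _ fun x h => absurd h hp
  filter_upwards [h] with x hx hxI
  obtain ⟨p, hp1, hp2⟩ := EReal.lt_iff_exists_rat_btwn.1 hxI.1
  obtain ⟨q, hq1, hq2⟩ := EReal.lt_iff_exists_rat_btwn.1 hxI.2
  refine hx p q ⟨hp1, hp2.trans hxI.2⟩ ⟨hxI.1.trans hq1, hq2⟩ (Set.mem_uIcc_of_le ?_ ?_)
  · exact_mod_cast hp2.le
  · exact_mod_cast hq1.le

theorem ACloc.add {D : DiracExpr} {u v : ℝ → C2} (hu : D.ACloc u) (hv : D.ACloc v) :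
    D.ACloc (u + v) := fun s hs t ht => (hu s hs t ht).add (hv s hs t ht)

theorem ACloc.smul {D : DiracExpr} {u : ℝ → C2} (k : ℂ) (hu : D.ACloc u) :
    D.ACloc (k • u) := by
  intro s hs t ht
  have h := hu s hs t ht
  unfold AbsolutelyContinuousOnInterval at h ⊢
  have h2 := h.const_mul ‖k‖
  rw [mul_zero] at h2
  refine h2.congr fun E => ?_
  simp only [Pi.smul_apply, dist_smul₀, Finset.mul_sum]

theorem tau_add {D : DiracExpr} {u v : ℝ → C2} {x : ℝ} (hu : DifferentiableAt ℝ u x)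
    (hv : DifferentiableAt ℝ v x) : D.tau (u + v) x = D.tau u x + D.tau v x := by
  unfold tau
  rw [deriv_add hu hv, Pi.add_apply, WithLp.ofLp_add, WithLp.ofLp_add, Matrix.mulVec_add,
    Matrix.mulVec_add, add_add_add_comm, WithLp.toLp_add]

theorem tau_smul {D : DiracExpr} {u : ℝ → C2} {x : ℝ} (k : ℂ) (hu : DifferentiableAt ℝ u x) :
    D.tau (k • u) x = k • D.tau u x := by
  unfold tau
  rw [deriv_const_smul k hu, Pi.smul_apply, WithLp.ofLp_smul, WithLp.ofLp_smul,
    Matrix.mulVec_smul, Matrix.mulVec_smul, ← smul_add, WithLp.toLp_smul]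

/-- The graph of the operator `f ↦ τ f` on the domain of all `f ∈ L²(I, ℂ²) ∩ AC_loc(I, ℂ²)` with
`τ f ∈ L²(I, ℂ²)` and `W_a(uminus, f) = W_b(uplus, f) = 0`. -/
def graphH (D : DiracExpr) (uminus uplus : ℝ → C2) : Submodule ℂ (D.L2 × D.L2) where
  carrier := {p | ∃ u : ℝ → C2, D.ACloc u ∧ (p.1 : ℝ → C2) =ᵐ[D.vol] u ∧
    (p.2 : ℝ → C2) =ᵐ[D.vol] D.tau u ∧
    Tendsto (wronskian uminus u) D.atA (𝓝 0) ∧ Tendsto (wronskian uplus u) D.atB (𝓝 0)}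
  add_mem' := by
    rintro ⟨f, g⟩ ⟨f', g'⟩ ⟨u, hu, h1, h2, h3, h4⟩ ⟨v, hv, k1, k2, k3, k4⟩
    have hw : ∀ w : ℝ → C2, wronskian w (u + v) = fun x => wronskian w u x + wronskian w v x := by
      intro w; funext x; simp only [wronskian, Pi.add_apply, PiLp.add_apply]; ring
    refine ⟨u + v, hu.add hv, ?_, ?_, ?_, ?_⟩
    · filter_upwards [Lp.coeFn_add f f', h1, k1] with x e1 e2 e3
      simp only [Prod.mk_add_mk] at *
      rw [e1, Pi.add_apply, e2, e3, Pi.add_apply]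
    · filter_upwards [Lp.coeFn_add g g', h2, k2, hu.ae_differentiableAt, hv.ae_differentiableAt]
        with x e1 e2 e3 e4 e5
      simp only [Prod.mk_add_mk] at *
      rw [e1, Pi.add_apply, e2, e3, tau_add e4 e5]
    · rw [hw]; simpa using h3.add k3
    · rw [hw]; simpa using h4.add k4
  zero_mem' := by
    refine ⟨0, ?_, ?_, ?_, ?_, ?_⟩
    · intro s _ t _
      unfold AbsolutelyContinuousOnInterval
      simpa using tendsto_const_nhds
    · exact Lp.coeFn_zero C2 2 D.vol
    · filter_upwards [Lp.coeFn_zero C2 2 D.vol] with x hx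
      have : deriv (0 : ℝ → C2) x = 0 := by simp
      simp only [Prod.snd_zero, hx, tau, this]
      simp
    · have : wronskian uminus 0 = fun _ => 0 := by funext x; simp [wronskian]
      rw [this]; exact tendsto_const_nhds
    · have : wronskian uplus 0 = fun _ => 0 := by funext x; simp [wronskian]
      rw [this]; exact tendsto_const_nhds
  smul_mem' := by
    rintro k ⟨f, g⟩ ⟨u, hu, h1, h2, h3, h4⟩
    have hw : ∀ w : ℝ → C2, wronskian w (k • u) = fun x => k * wronskian w u x := by
      intro w; funext x; simp only [wronskian, Pi.smul_apply, PiLp.smul_apply, smul_eq_mul]; ring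
    refine ⟨k • u, hu.smul k, ?_, ?_, ?_, ?_⟩
    · filter_upwards [Lp.coeFn_smul k f, h1] with x e1 e2
      simp only [Prod.smul_mk] at *
      rw [e1, Pi.smul_apply, e2, Pi.smul_apply]
    · filter_upwards [Lp.coeFn_smul k g, h2, hu.ae_differentiableAt] with x e1 e2 e4
      simp only [Prod.smul_mk] at *
      rw [e1, Pi.smul_apply, e2, tau_smul k e4]
    · rw [hw]; simpa using h3.const_mul k
    · rw [hw]; simpa using h4.const_mul k

/-- The graph above is single-valued, so that it is the graph of an operator. -/
theorem graphH_single_valued (D : DiracExpr) (uminus uplus : ℝ → C2) :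
    ∀ p ∈ D.graphH uminus uplus, p.1 = 0 → p.2 = 0 := by
  rintro ⟨f, g⟩ ⟨u, hu, h1, h2, -, -⟩ (rfl : f = 0)
  have hI : IsOpen D.I :=
    (isOpen_lt continuous_const continuous_coe_real_ereal).inter
      (isOpen_lt continuous_coe_real_ereal continuous_const)
  have hcont : ContinuousOn u D.I := by
    intro x hx
    obtain ⟨p, hp1, hp2⟩ := EReal.lt_iff_exists_real_btwn.1 hx.1
    obtain ⟨q, hq1, hq2⟩ := EReal.lt_iff_exists_real_btwn.1 hx.2
    have hp2' : p < x := by exact_mod_cast hp2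
    have hq1' : x < q := by exact_mod_cast hq1
    have h := (hu p ⟨hp1, hp2.trans hx.2⟩ q ⟨hx.1.trans hq1, hq2⟩).continuousOn
    refine (h.continuousAt ?_).continuousWithinAt
    rw [Set.uIcc_of_le (hp2'.trans hq1').le]
    exact Icc_mem_nhds hp2' hq1'
  have hzero : Set.EqOn u 0 D.I := by
    refine Measure.eqOn_open_of_ae_eq (μ := volume) ?_ hI hcont continuousOn_const
    filter_upwards [h1, Lp.coeFn_zero C2 2 D.vol] with x e1 e2
    rw [← e1]; exact e2
  refine (Lp.eq_zero_iff_ae_eq_zero).2 ?_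
  filter_upwards [h2, ae_restrict_mem hI.measurableSet] with x e hx
  have hd : deriv u x = 0 := by
    have : u =ᶠ[𝓝 x] fun _ => (0 : C2) := by
      filter_upwards [hI.mem_nhds hx] with y hy using hzero hy
    rw [this.deriv_eq]; simp
  rw [e, tau, hd, hzero hx]
  simp

/-- The operator `H f = τ f` in `L²(I, ℂ²)` with boundary conditions generated by `uminus` at `a`
and by `uplus` at `b`. -/
def H (D : DiracExpr) (uminus uplus : ℝ → C2) : D.L2 →ₗ.[ℂ] D.L2 :=
  (D.graphH uminus uplus).toLinearPMap

theorem graph_H (D : DiracExpr) (uminus uplus : ℝ → C2) :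
    (D.H uminus uplus).graph = D.graphH uminus uplus :=
  Submodule.toLinearPMap_graph_eq _ (fun p hp h => D.graphH_single_valued uminus uplus p hp h)

/-- `u` lies in the domain of `H` near `b` (for solutions `u`): it is square integrable near `b`
and satisfies the boundary condition of `H` there. -/
def InDomainNearB (D : DiracExpr) (uplus u : ℝ → C2) : Prop :=
  D.L2NearB u ∧ Tendsto (wronskian uplus u) D.atB (𝓝 0)

/-- `Φ₀`, `Θ₀` are real-valued solutions of `τ u = lam0 u` with `W(Θ₀, Φ₀) = 1` such that
`W_x(Φ₀, u)` and `W_x(Θ₀, u)` have limits as `x → a`, for all solutions `u` of `τ u = z u` and all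
complex `z`. -/
def LimitHypothesis (D : DiracExpr) (lam0 : ℝ) (Φ₀ Θ₀ : ℝ → C2) : Prop :=
  D.IsSolution (lam0 : ℂ) Φ₀ ∧ D.IsSolution (lam0 : ℂ) Θ₀ ∧
  D.IsRealValued Φ₀ ∧ D.IsRealValued Θ₀ ∧
  (∀ x ∈ D.I, wronskian Θ₀ Φ₀ x = 1) ∧
  ∀ (z : ℂ) (u : ℝ → C2), D.IsSolution z u →
    (∃ l : ℂ, Tendsto (wronskian Φ₀ u) D.atA (𝓝 l)) ∧
    (∃ l : ℂ, Tendsto (wronskian Θ₀ u) D.atA (𝓝 l))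

/-- `c(z,·)`, `s(z,·)` are the solutions of `τ u = z u` with `c(z,x₀) = (1,0)`,
`s(z,x₀) = (0,1)`, for every complex `z`. -/
def IsFundamentalSystem (D : DiracExpr) (x₀ : ℝ) (cs sn : ℂ → ℝ → C2) : Prop :=
  ∀ z : ℂ, D.IsSolution z (cs z) ∧ cs z x₀ 0 = 1 ∧ cs z x₀ 1 = 0 ∧
    D.IsSolution z (sn z) ∧ sn z x₀ 0 = 0 ∧ sn z x₀ 1 = 1

/-- `W_a(f,g) = lim_{x → a} W_x(f,g)`; used only where the limit exists. -/
def wronskianA (D : DiracExpr) (f g : ℝ → C2) : ℂ := limUnder D.atA (wronskian f g)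

/-- The solution `W_a(c(z), u₀) s(z,·) - W_a(s(z), u₀) c(z,·)`; it is `Φ(z,·)` for `u₀ = Φ₀` and
`Θ(z,·)` for `u₀ = Θ₀`. -/
def limitSolution (D : DiracExpr) (cs sn : ℂ → ℝ → C2) (u₀ : ℝ → C2) (z : ℂ) : ℝ → C2 :=
  fun x => D.wronskianA (cs z) u₀ • sn z x - D.wronskianA (sn z) u₀ • cs z x

/-- `Ψ(z,x) = Θ(z,x) + w Φ(z,x)`. -/
def Psi (D : DiracExpr) (cs sn : ℂ → ℝ → C2) (Φ₀ Θ₀ : ℝ → C2) (z w : ℂ) : ℝ → C2 :=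
  fun x => D.limitSolution cs sn Θ₀ z x + w • D.limitSolution cs sn Φ₀ z x

end DiracExpr

end

/-!
The proof rests on the Lagrange identity `W(f, g)' = τf · g - f · τg`, where `·` is the bilinear
pairing of `ℂ²`, and on the Plücker relation of Wronskians. The latter expresses `W_a(f, g)` through
the boundary values of `f` and `g` with respect to `Θ₀`, `Φ₀`. No existence or uniqueness theorem
for the differential equation is needed, since any two solutions with Wronskian `1` span all others
by Cramer's rule.

*Near `a`.* For nonreal `z` the Lagrange identity for `ū` and `u` bounds `∫ |u|²` near `a` by the
convergent boundary form `W(ū, u)`. The solutions `Θ₀`, `Φ₀`, and through them all solutions, are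
combinations with convergent coefficients of such solutions, so every solution is square integrable
near `a` (`LimitHypothesis.memLp_nearA`). The boundary values of `Ψ(z) = Θ(z) + w Φ(z)` at `a` are
those of `Θ₀ + w Φ₀` (`tendsto_wronskian_Psi`).

*Near `b`.* Two solutions that satisfy the conditions at `b` lie in the domain of `H` after a cutoff
near `a`. Symmetry of `H` then says that their boundary form at `b` vanishes
(`tendsto_wronskian_atB`). This needs neither a distinction of the limit point and limit circle
cases nor that `u₊` is real.

*The key identity.* If `Ψ = Θ(z) + w Φ(z)` and `Ψ' = Θ(z') + w' Φ(z')` both satisfy the conditions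
at `b`, then the Lagrange identity for the conjugate of `Ψ` and `Ψ'` on all of `I` reads
`w' - w̄ = (z' - z̄) ⟪Ψ, Ψ'⟫` (`sub_conj_eq_mul_integral_inner`). With `z' = z`, `w' = w` it is the
formula for `Im M`. With `z' = z̄` it gives `w' = w̄`, hence the symmetry `M(z̄) = M(z)̄` and the
uniqueness of `M(z)`. With `z̄₀` in place of `z` it reads
`M(z') - M(z₀) = (z' - z₀) ⟪Ψ(z̄₀), Ψ(z')⟫`, so that `M` is holomorphic once `z ↦ Ψ(z)` is continuous into `L²`. The continuity is the resolvent
estimate applied to `Ψ(z') - Ψ(z)`, which lies in the domain of `H`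
(`abs_im_mul_norm_toLp_sub_le`).

*Existence.* For nonreal `z` the operator `H - z` is onto. If `(H - z) u = g`, where `g` is the
conjugate of `Φ(z)` on a compact interval and `0` elsewhere, then `W(u, Φ(z))` is `0` to the left of
the interval and `∫ |Φ(z)|² > 0` to the right of it, so to the right `u` is a nonzero multiple of
some `Ψ(z)` (`exists_inDomainNearB`).
-/

noncomputable section

/-! ### Absolutely continuous functions -/

theorem LipschitzWith.comp_absolutelyContinuousOnInterval {X Y : Type*} [PseudoMetricSpace X]
    [PseudoMetricSpace Y] {K : NNReal} {φ : X → Y} (hφ : LipschitzWith K φ) {f : ℝ → X} {a b : ℝ}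
    (hf : AbsolutelyContinuousOnInterval f a b) :
    AbsolutelyContinuousOnInterval (fun x => φ (f x)) a b := by
  unfold AbsolutelyContinuousOnInterval at hf ⊢
  refine squeeze_zero (fun E => Finset.sum_nonneg fun i _ => dist_nonneg) (fun E => ?_)
    (by simpa using hf.const_mul (K : ℝ))
  rw [Finset.mul_sum]
  exact Finset.sum_le_sum fun i _ => hφ.dist_le_mul _ _

/-- The fundamental theorem of calculus for complex-valued absolutely continuous functions. -/
theorem AbsolutelyContinuousOnInterval.intervalIntegrable_and_integral_eq_sub {f f' : ℝ → ℂ}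
    {a b : ℝ} (hf : AbsolutelyContinuousOnInterval f a b)
    (hf' : ∀ᵐ x, x ∈ Set.uIcc a b → HasDerivAt f (f' x) x) :
    IntervalIntegrable f' volume a b ∧ ∫ x in a..b, f' x = f b - f a := by
  have hre : AbsolutelyContinuousOnInterval (fun x => (f x).re) a b :=
    (Complex.reCLM.lipschitz).comp_absolutelyContinuousOnInterval hf
  have him : AbsolutelyContinuousOnInterval (fun x => (f x).im) a b :=
    (Complex.imCLM.lipschitz).comp_absolutelyContinuousOnInterval hf
  have ere : ∀ᵐ x, x ∈ Set.uIoc a b → deriv (fun x => (f x).re) x = (f' x).re := by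
    filter_upwards [hf'] with x hx hxu
    exact ((Complex.reCLM.hasFDerivAt.comp_hasDerivAt x
      (hx (Set.uIoc_subset_uIcc hxu)) :)).deriv
  have eim : ∀ᵐ x, x ∈ Set.uIoc a b → deriv (fun x => (f x).im) x = (f' x).im := by
    filter_upwards [hf'] with x hx hxu
    exact ((Complex.imCLM.hasFDerivAt.comp_hasDerivAt x
      (hx (Set.uIoc_subset_uIcc hxu)) :)).deriv
  have ire := hre.intervalIntegrable_deriv.congr_ae
    ((ae_restrict_iff' measurableSet_uIoc).2 ere)
  have iim := him.intervalIntegrable_deriv.congr_ae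
    ((ae_restrict_iff' measurableSet_uIoc).2 eim)
  have key : f' = fun x => ((f' x).re : ℂ) + ((f' x).im : ℂ) * Complex.I := by
    funext x; exact (Complex.re_add_im _).symm
  have ire' : IntervalIntegrable (fun x => ((f' x).re : ℂ)) volume a b :=
    ⟨ire.1.ofReal, ire.2.ofReal⟩
  have iim' : IntervalIntegrable (fun x => ((f' x).im : ℂ)) volume a b :=
    ⟨iim.1.ofReal, iim.2.ofReal⟩
  refine ⟨by rw [key]; exact ire'.add (iim'.mul_const _), ?_⟩
  have h1 : ∫ x in a..b, (f' x).re = (f b).re - (f a).re := by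
    rw [← hre.integral_deriv_eq_sub]
    exact (intervalIntegral.integral_congr_ae ere).symm
  have h2 : ∫ x in a..b, (f' x).im = (f b).im - (f a).im := by
    rw [← him.integral_deriv_eq_sub]
    exact (intervalIntegral.integral_congr_ae eim).symm
  rw [key, intervalIntegral.integral_add ire' (iim'.mul_const _),
    intervalIntegral.integral_mul_const, intervalIntegral.integral_ofReal,
    intervalIntegral.integral_ofReal, h1, h2]
  apply Complex.ext <;> simp

/-! ### Algebra of the Wronskian -/

/-- The bilinear (not sesquilinear) pairing `u₁ v₁ + u₂ v₂` on `ℂ²`. -/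
def dotC (u v : C2) : ℂ := u 0 * v 0 + u 1 * v 1

/-- The componentwise complex conjugate of a `ℂ²`-valued function. -/
def conjC (u : ℝ → C2) (x : ℝ) : C2 := WithLp.toLp 2 fun i => starRingEnd ℂ (u x i)

@[simp] theorem conjC_apply (u : ℝ → C2) (x : ℝ) (i : Fin 2) :
    conjC u x i = starRingEnd ℂ (u x i) := rfl

/-- The Hermitian inner product of `ℂ²` is the bilinear pairing with the first factor conjugated. -/
theorem dotC_conjC (u v : ℝ → C2) (x : ℝ) : dotC (conjC u x) (v x) = inner ℂ (u x) (v x) := by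
  simp [dotC, PiLp.inner_apply, Fin.sum_univ_two, mul_comm]

theorem dotC_conjC_self (u : ℝ → C2) (x : ℝ) :
    dotC (conjC u x) (u x) = ((‖u x‖ ^ 2 : ℝ) : ℂ) := by
  rw [dotC_conjC, inner_self_eq_norm_sq_to_K]
  norm_cast

theorem dotC_smul_left (k : ℂ) (u v : C2) : dotC (k • u) v = k * dotC u v := by
  simp [dotC]; ring

theorem dotC_smul_right (k : ℂ) (u v : C2) : dotC u (k • v) = k * dotC u v := by
  simp [dotC]; ring

theorem dotC_add_left (u v w : C2) : dotC (u + v) w = dotC u w + dotC v w := by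
  simp [dotC]; ring

theorem wronskian_antisymm (f g : ℝ → C2) (x : ℝ) : wronskian f g x = -wronskian g f x := by
  simp only [wronskian]; ring

theorem wronskian_conjC (f g : ℝ → C2) (x : ℝ) :
    wronskian (conjC f) (conjC g) x = starRingEnd ℂ (wronskian f g x) := by
  simp [wronskian]

/-- The Plücker relation. -/
theorem wronskian_mul_wronskian (f g h k : ℝ → C2) (x : ℝ) :
    wronskian f g x * wronskian h k x =
      wronskian f h x * wronskian g k x - wronskian f k x * wronskian g h x := by
  simp only [wronskian]; ring

/-- Cramer's rule: two functions with Wronskian `W(h, k)` span `ℂ²` wherever it is nonzero. -/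
theorem wronskian_smul (h k u : ℝ → C2) (x : ℝ) :
    wronskian h k x • u x = wronskian u k x • h x + wronskian h u x • k x := by
  ext i
  fin_cases i <;> simp [wronskian] <;> ring

theorem wronskian_sub_right (w u v : ℝ → C2) (x : ℝ) :
    wronskian w (fun y => u y - v y) x = wronskian w u x - wronskian w v x := by
  simp [wronskian]; ring

theorem wronskian_add_smul_left (w u v : ℝ → C2) (k l : ℂ) (x : ℝ) :
    wronskian (fun y => k • u y + l • v y) w x = k * wronskian u w x + l * wronskian v w x := by
  simp [wronskian]; ring

theorem wronskian_congr_right {w u v : ℝ → C2} {x : ℝ} (h : u x = v x) :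
    wronskian w u x = wronskian w v x := by
  simp [wronskian, h]

theorem wronskian_congr_left {w u v : ℝ → C2} {x : ℝ} (h : u x = v x) :
    wronskian u w x = wronskian v w x := by
  simp [wronskian, h]

namespace DiracExpr

variable {D : DiracExpr}

/-! ### The interval and its end filters -/

theorem isOpen_I (D : DiracExpr) : IsOpen D.I :=
  (isOpen_lt continuous_const continuous_coe_real_ereal).inter
    (isOpen_lt continuous_coe_real_ereal continuous_const)

theorem measurableSet_I (D : DiracExpr) : MeasurableSet D.I := D.isOpen_I.measurableSet

theorem Icc_subset_I {s t : ℝ} (hs : s ∈ D.I) (ht : t ∈ D.I) : Set.Icc s t ⊆ D.I := fun _ hx =>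
  ⟨hs.1.trans_le (EReal.coe_le_coe_iff.2 hx.1), (EReal.coe_le_coe_iff.2 hx.2).trans_lt ht.2⟩

theorem uIcc_subset_I {s t : ℝ} (hs : s ∈ D.I) (ht : t ∈ D.I) : Set.uIcc s t ⊆ D.I := by
  rcases le_total s t with h | h
  · rw [Set.uIcc_of_le h]; exact Icc_subset_I hs ht
  · rw [Set.uIcc_of_ge h]; exact Icc_subset_I ht hs

theorem exists_lt_mem_I {c : ℝ} (hc : c ∈ D.I) : ∃ p ∈ D.I, p < c := by
  obtain ⟨p, h1, h2⟩ := EReal.lt_iff_exists_real_btwn.1 hc.1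
  exact ⟨p, ⟨h1, h2.trans hc.2⟩, by exact_mod_cast h2⟩

theorem exists_gt_mem_I {c : ℝ} (hc : c ∈ D.I) : ∃ p ∈ D.I, c < p := by
  obtain ⟨p, h1, h2⟩ := EReal.lt_iff_exists_real_btwn.1 hc.2
  exact ⟨p, ⟨hc.1.trans h1, h2⟩, by exact_mod_cast h1⟩

theorem eventually_atA {c : ℝ} (hc : c ∈ D.I) : ∀ᶠ x in D.atA, x ∈ D.I ∧ x < c := by
  have h : ∀ᶠ y in 𝓝[>] D.a, D.a < y ∧ y < (c : EReal) := Ioo_mem_nhdsGT hc.1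
  filter_upwards [h.comap (fun x : ℝ => (x : EReal))] with x hx
  exact ⟨⟨hx.1, hx.2.trans hc.2⟩, by exact_mod_cast hx.2⟩

theorem eventually_atB {c : ℝ} (hc : c ∈ D.I) : ∀ᶠ x in D.atB, x ∈ D.I ∧ c < x := by
  have h : ∀ᶠ y in 𝓝[<] D.b, (c : EReal) < y ∧ y < D.b := Ioo_mem_nhdsLT hc.2
  filter_upwards [h.comap (fun x : ℝ => (x : EReal))] with x hx
  exact ⟨⟨hc.1.trans hx.1, hx.2⟩, by exact_mod_cast hx.1⟩

instance : D.atA.NeBot := by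
  refine comap_neBot fun t ht => ?_
  obtain ⟨u, hu, hut⟩ := (mem_nhdsGT_iff_exists_Ioo_subset' D.a_lt_b).1 ht
  obtain ⟨p, h1, h2⟩ := EReal.lt_iff_exists_real_btwn.1 hu
  exact ⟨p, hut ⟨h1, h2⟩⟩

instance : D.atB.NeBot := by
  refine comap_neBot fun t ht => ?_
  obtain ⟨u, hu, hut⟩ := (mem_nhdsLT_iff_exists_Ioo_subset' D.a_lt_b).1 ht
  obtain ⟨p, h1, h2⟩ := EReal.lt_iff_exists_real_btwn.1 hu
  exact ⟨p, hut ⟨h1, h2⟩⟩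

instance : D.atA.IsCountablyGenerated := by unfold atA; infer_instance

instance : D.atB.IsCountablyGenerated := by unfold atB; infer_instance

/-- Integrals over `I` are limits of integrals over `(s, t]` as `s → a` and `t → b`. -/
theorem aecover_I (D : DiracExpr) :
    AECover D.vol (D.atA ×ˢ D.atB) fun p : ℝ × ℝ => Set.Ioc p.1 p.2 where
  ae_eventually_mem := by
    filter_upwards [ae_restrict_mem D.measurableSet_I] with x hx
    filter_upwards [(eventually_atA hx).prod_inl _, (eventually_atB hx).prod_inr _] with p h1 h2
    exact ⟨h1.2, h2.2.le⟩
  measurableSet _ := measurableSet_Ioc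

/-! ### Locally absolutely continuous functions and the Lagrange identity -/

theorem ACloc.continuousOn {u : ℝ → C2} (hu : D.ACloc u) : ContinuousOn u D.I := by
  intro x hx
  obtain ⟨p, hp, hpx⟩ := exists_lt_mem_I hx
  obtain ⟨q, hq, hxq⟩ := exists_gt_mem_I hx
  have h := (hu p hp q hq).continuousOn
  refine (h.continuousAt ?_).continuousWithinAt
  rw [Set.uIcc_of_le (hpx.trans hxq).le]
  exact Icc_mem_nhds hpx hxq

theorem ACloc.component {u : ℝ → C2} (hu : D.ACloc u) (i : Fin 2) {s t : ℝ} (hs : s ∈ D.I)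
    (ht : t ∈ D.I) : AbsolutelyContinuousOnInterval (fun x => u x i) s t :=
  ((EuclideanSpace.proj i : C2 →L[ℂ] ℂ).lipschitz).comp_absolutelyContinuousOnInterval
    (hu s hs t ht)

/-- Conjugation on `ℂ²` as a real-linear map. -/
def conjCLM : C2 →L[ℝ] C2 :=
  LinearMap.toContinuousLinearMap
    { toFun := fun v => WithLp.toLp 2 fun i => starRingEnd ℂ (v i)
      map_add' := fun u v => by ext i; simp
      map_smul' := fun k u => by ext i; simp }

theorem ACloc.conj {u : ℝ → C2} (hu : D.ACloc u) : D.ACloc (conjC u) := fun s hs t ht =>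
  conjCLM.lipschitz.comp_absolutelyContinuousOnInterval (hu s hs t ht)

theorem hasDerivAt_component {u : ℝ → C2} {x : ℝ} (hu : DifferentiableAt ℝ u x) (i : Fin 2) :
    HasDerivAt (fun y => u y i) (deriv u x i) x :=
  ((EuclideanSpace.proj i : C2 →L[ℂ] ℂ).restrictScalars ℝ).hasFDerivAt.comp_hasDerivAt x
    hu.hasDerivAt

theorem hasDerivAt_conjC {u : ℝ → C2} {x : ℝ} (hu : DifferentiableAt ℝ u x) :
    HasDerivAt (conjC u) (conjCLM (deriv u x)) x :=
  conjCLM.hasFDerivAt.comp_hasDerivAt x hu.hasDerivAt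

theorem tau_zero (u : ℝ → C2) (x : ℝ) : D.tau u x 0 =
    -deriv u x 1 + ((D.qel x + D.mass + D.qsc x : ℝ) * u x 0 + (D.qam x : ℝ) * u x 1) := by
  simp [tau, Q, pauli1, pauli2, pauli3, dotProduct, Fin.sum_univ_two]
  exact Or.inl (by ring)

theorem tau_one (u : ℝ → C2) (x : ℝ) : D.tau u x 1 =
    deriv u x 0 + ((D.qam x : ℝ) * u x 0 + (D.qel x - D.mass - D.qsc x : ℝ) * u x 1) := by
  simp [tau, Q, pauli1, pauli2, pauli3, dotProduct, Fin.sum_univ_two]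
  exact Or.inl (by ring)

theorem tau_conjC {u : ℝ → C2} {x : ℝ} (hu : DifferentiableAt ℝ u x) (i : Fin 2) :
    D.tau (conjC u) x i = starRingEnd ℂ (D.tau u x i) := by
  have h : deriv (conjC u) x = conjCLM (deriv u x) := (hasDerivAt_conjC hu).deriv
  have h' : ∀ v : C2, ∀ i, conjCLM v i = starRingEnd ℂ (v i) := fun _ _ => rfl
  fin_cases i
  · simp [tau_zero, h, h']
  · simp [tau_one, h, h']

/-- The pointwise Lagrange identity: the potential is symmetric, so it drops out. -/
theorem hasDerivAt_wronskian {f g : ℝ → C2} {x : ℝ} (hf : DifferentiableAt ℝ f x)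
    (hg : DifferentiableAt ℝ g x) :
    HasDerivAt (wronskian f g) (dotC (D.tau f x) (g x) - dotC (f x) (D.tau g x)) x := by
  have h := ((hasDerivAt_component hf 0).mul (hasDerivAt_component hg 1)).sub
    ((hasDerivAt_component hf 1).mul (hasDerivAt_component hg 0))
  refine h.congr_deriv ?_
  simp only [dotC, tau_zero, tau_one]
  ring

theorem ACloc.absolutelyContinuousOnInterval_wronskian {f g : ℝ → C2} (hf : D.ACloc f)
    (hg : D.ACloc g) {s t : ℝ} (hs : s ∈ D.I) (ht : t ∈ D.I) :
    AbsolutelyContinuousOnInterval (wronskian f g) s t :=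
  ((hf.component 0 hs ht).smul (hg.component 1 hs ht)).sub
    ((hf.component 1 hs ht).smul (hg.component 0 hs ht))

theorem ae_vol_iff {p : ℝ → Prop} : (∀ᵐ x ∂D.vol, p x) ↔ ∀ᵐ x, x ∈ D.I → p x :=
  ae_restrict_iff' D.measurableSet_I

/-- The integrated Lagrange identity. -/
theorem lagrange {f g : ℝ → C2} (hf : D.ACloc f) (hg : D.ACloc g) {s t : ℝ} (hs : s ∈ D.I)
    (ht : t ∈ D.I) :
    IntervalIntegrable (fun x => dotC (D.tau f x) (g x) - dotC (f x) (D.tau g x)) volume s t ∧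
    ∫ x in s..t, (dotC (D.tau f x) (g x) - dotC (f x) (D.tau g x)) =
      wronskian f g t - wronskian f g s := by
  refine AbsolutelyContinuousOnInterval.intervalIntegrable_and_integral_eq_sub
    (hf.absolutelyContinuousOnInterval_wronskian hg hs ht) ?_
  filter_upwards [ae_vol_iff.1 hf.ae_differentiableAt, ae_vol_iff.1 hg.ae_differentiableAt]
    with x h1 h2 hx
  exact hasDerivAt_wronskian (h1 (uIcc_subset_I hs ht hx)) (h2 (uIcc_subset_I hs ht hx))

/-- The Lagrange identity when `τ f` and `τ g` are known almost everywhere. -/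
theorem lagrange_of_ae {f g : ℝ → C2} (hf : D.ACloc f) (hg : D.ACloc g) {h : ℝ → ℂ}
    (hh : ∀ᵐ x ∂D.vol, dotC (D.tau f x) (g x) - dotC (f x) (D.tau g x) = h x) {s t : ℝ}
    (hs : s ∈ D.I) (ht : t ∈ D.I) :
    ∫ x in s..t, h x = wronskian f g t - wronskian f g s := by
  rw [← (lagrange hf hg hs ht).2]
  refine intervalIntegral.integral_congr_ae ?_
  filter_upwards [ae_vol_iff.1 hh] with x hx hxu
  exact (hx (uIcc_subset_I hs ht (Set.uIoc_subset_uIcc hxu))).symm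

/-- The Lagrange identity over the whole interval. -/
theorem tendsto_wronskian_sub {f g : ℝ → C2} (hf : D.ACloc f) (hg : D.ACloc g) {h : ℝ → ℂ}
    (hh : ∀ᵐ x ∂D.vol, dotC (D.tau f x) (g x) - dotC (f x) (D.tau g x) = h x)
    (hi : Integrable h D.vol) :
    Tendsto (fun p : ℝ × ℝ => wronskian f g p.2 - wronskian f g p.1) (D.atA ×ˢ D.atB)
      (𝓝 (∫ x, h x ∂D.vol)) := by
  refine (D.aecover_I.integral_tendsto_of_countably_generated hi).congr' ?_
  obtain ⟨c, hc⟩ : ∃ c, c ∈ D.I := by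
    obtain ⟨c, h1, h2⟩ := EReal.lt_iff_exists_real_btwn.1 D.a_lt_b
    exact ⟨c, h1, h2⟩
  filter_upwards [(eventually_atA hc).prod_inl _, (eventually_atB hc).prod_inr _] with p h1 h2
  rw [← lagrange_of_ae hf hg hh h1.1 h2.1, intervalIntegral.integral_of_le (h1.2.trans h2.2).le,
    vol, Measure.restrict_restrict measurableSet_Ioc, Set.inter_eq_left.2]
  exact Set.Ioc_subset_Icc_self.trans (Icc_subset_I h1.1 h2.1)

/-! ### Solutions -/

/-- The potential matrix is real, so conjugation turns solutions for `z` into solutions for `z̄`. -/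
theorem IsSolution.conj {z : ℂ} {u : ℝ → C2} (hu : D.IsSolution z u) :
    D.IsSolution (starRingEnd ℂ z) (conjC u) := by
  refine ⟨hu.1.conj, ?_⟩
  filter_upwards [hu.2, hu.1.ae_differentiableAt] with x h1 h2
  ext i
  rw [tau_conjC h2, h1]
  simp

theorem IsSolution.combination {z : ℂ} {u v : ℝ → C2} (hu : D.IsSolution z u)
    (hv : D.IsSolution z v) (k l : ℂ) : D.IsSolution z (fun x => k • u x + l • v x) := by
  have e : (fun x => k • u x + l • v x) = k • u + l • v := rfl
  rw [e]
  refine ⟨(hu.1.smul k).add (hv.1.smul l), ?_⟩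
  filter_upwards [hu.2, hv.2, hu.1.ae_differentiableAt, hv.1.ae_differentiableAt] with x h1 h2 h3 h4
  rw [tau_add (h3.const_smul k) (h4.const_smul l), tau_smul k h3, tau_smul l h4, h1, h2]
  simp only [Pi.add_apply, Pi.smul_apply, smul_add, smul_comm z]

/-- If `τ u = z u + g` and `τ v = z v`, then `W(u, v)' = g · v`. -/
theorem wronskian_sub_eq_integral {z : ℂ} {u v g : ℝ → C2} (hu : D.ACloc u)
    (hug : ∀ᵐ x ∂D.vol, D.tau u x = z • u x + g x) (hv : D.IsSolution z v) {s t : ℝ}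
    (hs : s ∈ D.I) (ht : t ∈ D.I) :
    ∫ x in s..t, dotC (g x) (v x) = wronskian u v t - wronskian u v s := by
  refine lagrange_of_ae hu hv.1 ?_ hs ht
  filter_upwards [hug, hv.2] with x h1 h2
  rw [h1, h2, dotC_add_left, dotC_smul_left, dotC_smul_right]
  ring

/-- The Wronskian of two solutions for the same `z` is constant. -/
theorem IsSolution.wronskian_eq {z : ℂ} {u v : ℝ → C2} (hu : D.IsSolution z u)
    (hv : D.IsSolution z v) {s t : ℝ} (hs : s ∈ D.I) (ht : t ∈ D.I) :
    wronskian u v t = wronskian u v s := by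
  have h := wronskian_sub_eq_integral (g := fun _ => 0) hu.1 (by simpa using hu.2) hv hs ht
  simpa [dotC, sub_eq_zero, eq_comm] using h

/-! ### Square integrability near the left endpoint -/

/-- The part of `I` to the left of `c`. -/
def nearA (D : DiracExpr) (c : ℝ) : Set ℝ := {x : ℝ | D.a < (x : EReal) ∧ x < c}

/-- The part of `I` to the right of `c`. -/
def nearB (D : DiracExpr) (c : ℝ) : Set ℝ := {x : ℝ | c < x ∧ (x : EReal) < D.b}

theorem measurableSet_nearA (D : DiracExpr) (c : ℝ) : MeasurableSet (D.nearA c) :=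
  (measurableSet_lt measurable_const measurable_coe_real_ereal).inter measurableSet_Iio

theorem measurableSet_nearB (D : DiracExpr) (c : ℝ) : MeasurableSet (D.nearB c) :=
  measurableSet_Ioi.inter (measurableSet_lt measurable_coe_real_ereal measurable_const)

theorem nearA_subset_I {c : ℝ} (hc : c ∈ D.I) : D.nearA c ⊆ D.I := fun _ hx =>
  ⟨hx.1, (EReal.coe_lt_coe_iff.2 hx.2).trans hc.2⟩

theorem nearB_subset_I {c : ℝ} (hc : c ∈ D.I) : D.nearB c ⊆ D.I := fun _ hx =>
  ⟨hc.1.trans (EReal.coe_lt_coe_iff.2 hx.1), hx.2⟩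

/-- Every property that holds eventually at `a` holds on a one-sided neighborhood `nearA p`. -/
theorem exists_forall_nearA {P : ℝ → Prop} (h : ∀ᶠ x in D.atA, P x) :
    ∃ p ∈ D.I, ∀ x ∈ D.nearA p, P x := by
  obtain ⟨t, ht, hP⟩ := mem_comap.1 h
  obtain ⟨u, hu, hut⟩ := (mem_nhdsGT_iff_exists_Ioo_subset' D.a_lt_b).1 ht
  obtain ⟨p, h1, h2⟩ := EReal.lt_iff_exists_real_btwn.1 (lt_min hu D.a_lt_b)
  exact ⟨p, ⟨h1, h2.trans_le (min_le_right _ _)⟩, fun x hx => hP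
    (hut ⟨hx.1, (EReal.coe_lt_coe_iff.2 hx.2).trans (h2.trans_le (min_le_left _ _))⟩)⟩

theorem memLp_iff_of_continuousOn {u : ℝ → C2} (hu : ContinuousOn u D.I) {S : Set ℝ}
    (hS : MeasurableSet S) (hSI : S ⊆ D.I) :
    MemLp u 2 (volume.restrict S) ↔ IntegrableOn (fun x => ‖u x‖ ^ 2) S :=
  memLp_two_iff_integrable_sq_norm ((hu.mono hSI).aestronglyMeasurable hS)

theorem integrableOn_Icc_sq {u : ℝ → C2} (hu : ContinuousOn u D.I) {s t : ℝ} (hs : s ∈ D.I)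
    (ht : t ∈ D.I) : IntegrableOn (fun x => ‖u x‖ ^ 2) (Set.Icc s t) :=
  ((hu.mono (Icc_subset_I hs ht)).norm.pow 2).integrableOn_Icc

theorem memLp_nearA_mono {u : ℝ → C2} (hu : ContinuousOn u D.I) {p c : ℝ} (hp : p ∈ D.I)
    (hc : c ∈ D.I) (h : MemLp u 2 (volume.restrict (D.nearA p))) :
    MemLp u 2 (volume.restrict (D.nearA c)) := by
  rw [memLp_iff_of_continuousOn hu (D.measurableSet_nearA _) (nearA_subset_I hp)] at h
  rw [memLp_iff_of_continuousOn hu (D.measurableSet_nearA _) (nearA_subset_I hc)]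
  refine (h.union (integrableOn_Icc_sq hu hp hc)).mono_set fun x hx => ?_
  rcases lt_or_ge x p with h' | h'
  · exact Or.inl ⟨hx.1, h'⟩
  · exact Or.inr ⟨h', hx.2.le⟩

theorem l2NearB_of_nearB {u : ℝ → C2} (hu : ContinuousOn u D.I) {p : ℝ} (hp : p ∈ D.I)
    (h : MemLp u 2 (volume.restrict (D.nearB p))) : D.L2NearB u := by
  intro c hc
  change MemLp u 2 (volume.restrict (D.nearB c))
  rw [memLp_iff_of_continuousOn hu (D.measurableSet_nearB _) (nearB_subset_I hp)] at h
  rw [memLp_iff_of_continuousOn hu (D.measurableSet_nearB _) (nearB_subset_I hc)]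
  refine (h.union (integrableOn_Icc_sq hu hc hp)).mono_set fun x hx => ?_
  rcases lt_or_ge p x with h' | h'
  · exact Or.inl ⟨h', hx.2⟩
  · exact Or.inr ⟨hx.1.le, h'⟩

theorem memLp_vol {u : ℝ → C2} (hu : ContinuousOn u D.I) {c : ℝ} (hc : c ∈ D.I)
    (h : MemLp u 2 (volume.restrict (D.nearA c))) (h' : D.L2NearB u) : MemLp u 2 D.vol := by
  obtain ⟨p, hp, hpc⟩ := exists_lt_mem_I hc
  have h'' : MemLp u 2 (volume.restrict (D.nearB p)) := h' p hp
  rw [memLp_iff_of_continuousOn hu (D.measurableSet_nearA _) (nearA_subset_I hc)] at h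
  rw [memLp_iff_of_continuousOn hu (D.measurableSet_nearB _) (nearB_subset_I hp)] at h''
  refine (memLp_iff_of_continuousOn hu D.measurableSet_I subset_rfl).2
    ((h.union h'').mono_set fun x hx => ?_)
  rcases lt_or_ge x c with h1 | h1
  · exact Or.inl ⟨hx.1, h1⟩
  · exact Or.inr ⟨hpc.trans_le h1, hx.2⟩

theorem aecover_nearA {c : ℝ} (hc : c ∈ D.I) :
    AECover (volume.restrict (D.nearA c)) D.atA fun s => Set.Ioc s c where
  ae_eventually_mem := by
    filter_upwards [ae_restrict_mem (D.measurableSet_nearA c)] with x hx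
    filter_upwards [eventually_atA (nearA_subset_I hc hx)] with s hs
    exact ⟨hs.2, hx.2.le⟩
  measurableSet _ := measurableSet_Ioc

/-- The Lagrange identity for `ū` and `u`. -/
theorem conj_sub_self_mul_integral {z : ℂ} {u : ℝ → C2} (hu : D.IsSolution z u) {s t : ℝ}
    (hs : s ∈ D.I) (ht : t ∈ D.I) :
    (starRingEnd ℂ z - z) * ((∫ x in s..t, ‖u x‖ ^ 2 : ℝ) : ℂ) =
      wronskian (conjC u) u t - wronskian (conjC u) u s := by
  rw [← intervalIntegral.integral_ofReal, ← intervalIntegral.integral_const_mul]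
  refine lagrange_of_ae hu.1.conj hu.1 ?_ hs ht
  filter_upwards [hu.conj.2, hu.2] with x h1 h2
  rw [h1, h2, dotC_smul_left, dotC_smul_right, dotC_conjC_self]
  ring

/-- For nonreal `z`, a solution is square integrable near `a` as soon as `W(ū, u)` converges. -/
theorem IsSolution.memLp_nearA_of_tendsto {z : ℂ} (hz : z.im ≠ 0) {u : ℝ → C2}
    (hu : D.IsSolution z u) {l : ℂ} (hl : Tendsto (wronskian (conjC u) u) D.atA (𝓝 l))
    {c : ℝ} (hc : c ∈ D.I) : MemLp u 2 (volume.restrict (D.nearA c)) := by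
  have huc := hu.1.continuousOn
  rw [memLp_iff_of_continuousOn huc (D.measurableSet_nearA _) (nearA_subset_I hc)]
  obtain ⟨K, hK⟩ := (hl.const_sub (wronskian (conjC u) u c)).norm.isBoundedUnder_le
  rw [eventually_map] at hK
  have hz' : 0 < ‖starRingEnd ℂ z - z‖ := by
    rw [norm_pos_iff, sub_ne_zero]
    exact fun h => hz (Complex.conj_eq_iff_im.1 h)
  refine (aecover_nearA hc).integrable_of_lintegral_enorm_bounded (K / ‖starRingEnd ℂ z - z‖)
    (((huc.mono (nearA_subset_I hc)).norm.pow 2).aestronglyMeasurable (D.measurableSet_nearA c)) ?_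
  filter_upwards [hK, eventually_atA hc] with s hs hsc
  have hint : IntegrableOn (fun x => ‖u x‖ ^ 2) (Set.Ioc s c) :=
    (integrableOn_Icc_sq huc hsc.1 hc).mono_set Set.Ioc_subset_Icc_self
  calc ∫⁻ x in Set.Ioc s c, ‖‖u x‖ ^ 2‖ₑ ∂(volume.restrict (D.nearA c))
      ≤ ∫⁻ x in Set.Ioc s c, ‖‖u x‖ ^ 2‖ₑ :=
        lintegral_mono' (Measure.restrict_mono_measure Measure.restrict_le_self _) le_rfl
    _ = ENNReal.ofReal (∫ x in Set.Ioc s c, ‖‖u x‖ ^ 2‖) :=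
        (ofReal_integral_norm_eq_lintegral_enorm hint).symm
    _ ≤ _ := by
        refine ENNReal.ofReal_le_ofReal ((le_div_iff₀ hz').2 ?_)
        have h := congrArg norm (conj_sub_self_mul_integral hu hsc.1 hc)
        rw [intervalIntegral.integral_of_le hsc.2.le, norm_mul, Complex.norm_real] at h
        have h0 : (∫ x in Set.Ioc s c, ‖‖u x‖ ^ 2‖) = ∫ x in Set.Ioc s c, ‖u x‖ ^ 2 := by
          simp
        rw [h0, mul_comm]
        exact (mul_le_mul_of_nonneg_left (le_abs_self _) hz'.le).trans (h.le.trans hs)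

/-- A function that is a combination of square integrable functions, with coefficients that
converge at `a`, is square integrable near `a`. -/
theorem memLp_nearA_of_combination {u f g : ℝ → C2} {α β : ℝ → ℂ} {k l : ℂ}
    (hu : ContinuousOn u D.I) (hfg : ∀ x ∈ D.I, u x = α x • f x + β x • g x)
    (hα : Tendsto α D.atA (𝓝 k)) (hβ : Tendsto β D.atA (𝓝 l))
    (hf : ∀ c ∈ D.I, MemLp f 2 (volume.restrict (D.nearA c)))
    (hg : ∀ c ∈ D.I, MemLp g 2 (volume.restrict (D.nearA c)))
    {c : ℝ} (hc : c ∈ D.I) : MemLp u 2 (volume.restrict (D.nearA c)) := by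
  obtain ⟨K, hK⟩ := hα.norm.isBoundedUnder_le
  obtain ⟨L, hL⟩ := hβ.norm.isBoundedUnder_le
  rw [eventually_map] at hK hL
  obtain ⟨p, hp, h⟩ := exists_forall_nearA (hK.and hL)
  refine memLp_nearA_mono hu hp hc ?_
  refine MemLp.of_le_mul (c := max K L) ((hf p hp).norm.add (hg p hp).norm)
    ((hu.mono (nearA_subset_I hp)).aestronglyMeasurable (D.measurableSet_nearA p)) ?_
  filter_upwards [ae_restrict_mem (D.measurableSet_nearA p)] with x hx
  rw [hfg x (nearA_subset_I hp hx), Pi.add_apply, Real.norm_of_nonneg (by positivity), mul_add]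
  refine (norm_add_le _ _).trans (add_le_add ?_ ?_)
  · rw [norm_smul]
    exact mul_le_mul_of_nonneg_right ((h x hx).1.trans (le_max_left _ _)) (norm_nonneg _)
  · rw [norm_smul]
    exact mul_le_mul_of_nonneg_right ((h x hx).2.trans (le_max_right _ _)) (norm_nonneg _)

section LimitCircle

variable {lam0 : ℝ} {Φ₀ Θ₀ : ℝ → C2}

theorem LimitHypothesis.exists_tendsto (hlim : D.LimitHypothesis lam0 Φ₀ Θ₀) {z : ℂ} {u : ℝ → C2}
    (hu : D.IsSolution z u) :
    (∃ l, Tendsto (wronskian u Θ₀) D.atA (𝓝 l)) ∧ ∃ l, Tendsto (wronskian u Φ₀) D.atA (𝓝 l) := by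
  obtain ⟨⟨l, hl⟩, k, hk⟩ := hlim.2.2.2.2.2 z u hu
  exact ⟨⟨-k, hk.neg.congr fun x => (wronskian_antisymm _ _ _).symm⟩,
    ⟨-l, hl.neg.congr fun x => (wronskian_antisymm _ _ _).symm⟩⟩

theorem eventually_mem_atA (D : DiracExpr) : ∀ᶠ x in D.atA, x ∈ D.I := by
  obtain ⟨c, h1, h2⟩ := EReal.lt_iff_exists_real_btwn.1 D.a_lt_b
  exact (eventually_atA ⟨h1, h2⟩).mono fun x hx => hx.1

/-- `W_a(f, g)` in terms of the boundary values of `f` and `g` with respect to `Θ₀`, `Φ₀`. -/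
theorem LimitHypothesis.tendsto_wronskian (hlim : D.LimitHypothesis lam0 Φ₀ Θ₀) {f g : ℝ → C2}
    {f₁ f₂ g₁ g₂ : ℂ} (hf₁ : Tendsto (wronskian f Θ₀) D.atA (𝓝 f₁))
    (hf₂ : Tendsto (wronskian f Φ₀) D.atA (𝓝 f₂)) (hg₁ : Tendsto (wronskian g Θ₀) D.atA (𝓝 g₁))
    (hg₂ : Tendsto (wronskian g Φ₀) D.atA (𝓝 g₂)) :
    Tendsto (wronskian f g) D.atA (𝓝 (f₁ * g₂ - f₂ * g₁)) := by
  refine ((hf₁.mul hg₂).sub (hf₂.mul hg₁)).congr' ?_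
  filter_upwards [D.eventually_mem_atA] with x hx
  rw [← wronskian_mul_wronskian, hlim.2.2.2.2.1 x hx, mul_one]

theorem IsFundamentalSystem.wronskian_eq_one {x₀ : ℝ} (hx₀ : x₀ ∈ D.I) {cs sn : ℂ → ℝ → C2}
    (hcs : D.IsFundamentalSystem x₀ cs sn) (z : ℂ) {x : ℝ} (hx : x ∈ D.I) :
    wronskian (cs z) (sn z) x = 1 := by
  obtain ⟨h1, h2, h3, h4, h5, h6⟩ := hcs z
  rw [h1.wronskian_eq h4 hx₀ hx, wronskian, h2, h3, h5, h6]
  simp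

/-- Under the limit circle hypothesis at `a`, all solutions, for every spectral parameter, are
square integrable near `a`. For nonreal parameters this follows from the Lagrange identity. The
solutions `Θ₀`, `Φ₀` are then combinations, with convergent coefficients, of the solutions for the
parameter `i`, and all other solutions are such combinations of `Θ₀`, `Φ₀`. -/
theorem LimitHypothesis.memLp_nearA (hlim : D.LimitHypothesis lam0 Φ₀ Θ₀) {x₀ : ℝ}
    (hx₀ : x₀ ∈ D.I) {cs sn : ℂ → ℝ → C2} (hcs : D.IsFundamentalSystem x₀ cs sn) {z : ℂ}
    {u : ℝ → C2} (hu : D.IsSolution z u) {c : ℝ} (hc : c ∈ D.I) :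
    MemLp u 2 (volume.restrict (D.nearA c)) := by
  have nonreal : ∀ (w : ℂ) (v : ℝ → C2), w.im ≠ 0 → D.IsSolution w v → ∀ c ∈ D.I,
      MemLp v 2 (volume.restrict (D.nearA c)) := by
    intro w v hw hv c hc
    obtain ⟨⟨k, hk⟩, l, hl⟩ := hlim.exists_tendsto hv
    obtain ⟨⟨k', hk'⟩, l', hl'⟩ := hlim.exists_tendsto hv.conj
    exact hv.memLp_nearA_of_tendsto hw (hlim.tendsto_wronskian hk' hl' hk hl) hc
  obtain ⟨hC, -, -, hS, -, -⟩ := hcs Complex.I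
  -- `Θ₀` and `Φ₀` are combinations of the solutions for the nonreal parameter `i`
  have base : ∀ v : ℝ → C2, D.IsSolution lam0 v →
      (∃ l, Tendsto (wronskian v (sn Complex.I)) D.atA (𝓝 l)) →
      (∃ l, Tendsto (wronskian (cs Complex.I) v) D.atA (𝓝 l)) →
      ∀ c ∈ D.I, MemLp v 2 (volume.restrict (D.nearA c)) := by
    rintro v hv ⟨l, hl⟩ ⟨k, hk⟩ c hc
    refine memLp_nearA_of_combination hv.1.continuousOn (fun x hx => ?_) hl hk
      (nonreal _ _ (by simp) hC) (nonreal _ _ (by simp) hS) hc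
    rw [← wronskian_smul, hcs.wronskian_eq_one hx₀ _ hx, one_smul]
  have hC' := hlim.exists_tendsto hC
  have hS' := hlim.2.2.2.2.2 _ _ hS
  refine memLp_nearA_of_combination hu.1.continuousOn (fun x hx => ?_)
    (hlim.exists_tendsto hu).2.choose_spec (hlim.2.2.2.2.2 _ _ hu).2.choose_spec
    (base Θ₀ hlim.2.1 hS'.2 hC'.1) (base Φ₀ hlim.1 hS'.1 hC'.2) hc
  rw [← wronskian_smul, hlim.2.2.2.2.1 x hx, one_smul]

end LimitCircle

end DiracExpr

/-! ### The resolvent of a self-adjoint operator -/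

section SelfAdjoint

variable {E : Type*} [NormedAddCommGroup E] [InnerProductSpace ℂ E] [CompleteSpace E]
  {A : E →ₗ.[ℂ] E}

/-- The graph of a self-adjoint operator is maximal symmetric: it contains every pair that satisfies
the symmetry relation with all of its elements. -/
theorem IsSelfAdjoint.mem_graph_iff (hA : IsSelfAdjoint A) (p : E × E) :
    p ∈ A.graph ↔ ∀ x y, (x, y) ∈ A.graph → inner ℂ y p.1 = inner ℂ x p.2 := by
  conv_lhs => rw [← LinearPMap.isSelfAdjoint_def.1 hA]
  rw [LinearPMap.adjoint_graph_eq_graph_adjoint hA.dense_domain, Submodule.mem_adjoint_iff]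
  simp only [sub_eq_zero]

/-- The resolvent estimate `|Im z| ‖x‖ ≤ ‖A x - z x‖` of a self-adjoint operator. -/
theorem IsSelfAdjoint.abs_im_mul_norm_le (hA : IsSelfAdjoint A) {x y : E} (h : (x, y) ∈ A.graph)
    (z : ℂ) : |z.im| * ‖x‖ ≤ ‖y - z • x‖ := by
  rcases eq_or_ne x 0 with rfl | hx
  · simp
  have hsymm : inner ℂ y x = inner ℂ x y := (hA.mem_graph_iff _).1 h x y h
  have hreal : (inner ℂ x y : ℂ).im = 0 := by
    rw [← Complex.conj_eq_iff_im, inner_conj_symm, hsymm]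
  have him : (inner ℂ x (y - z • x) : ℂ).im = -(z.im * ‖x‖ ^ 2) := by
    rw [inner_sub_right, inner_smul_right, inner_self_eq_norm_sq_to_K, Complex.sub_im, hreal]
    simp [← Complex.ofReal_pow]
  have h1 : |z.im| * ‖x‖ ^ 2 ≤ ‖x‖ * ‖y - z • x‖ := by
    refine le_trans (le_of_eq ?_) ((Complex.abs_im_le_norm _).trans
      (norm_inner_le_norm (𝕜 := ℂ) _ _))
    rw [him, abs_neg, abs_mul, abs_of_nonneg (sq_nonneg ‖x‖)]
  have h2 : 0 < ‖x‖ := norm_pos_iff.2 hx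
  refine le_of_mul_le_mul_left ?_ h2
  linarith [h1, show ‖x‖ * (|z.im| * ‖x‖) = |z.im| * ‖x‖ ^ 2 by ring]

/-- For a self-adjoint operator `A` and nonreal `z`, the operator `A - z` is surjective. -/
theorem IsSelfAdjoint.exists_mem_graph_sub_smul_eq (hA : IsSelfAdjoint A) {z : ℂ} (hz : z.im ≠ 0)
    (g : E) : ∃ x y, (x, y) ∈ A.graph ∧ y - z • x = g := by
  let T : A.graph →L[ℂ] E :=
    (ContinuousLinearMap.snd ℂ E E - z • ContinuousLinearMap.fst ℂ E E).comp A.graph.subtypeL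
  have hT : ∀ p : A.graph, T p = (p : E × E).2 - z • (p : E × E).1 := fun _ => rfl
  have hclosed : IsClosed (A.graph : Set (E × E)) := hA.isClosed
  have : CompleteSpace A.graph := hclosed.completeSpace_coe
  have hpos : 0 < |z.im| := abs_pos.2 hz
  -- the resolvent estimate bounds the graph norm, so that the range of `A - z` is closed
  have hanti : AntilipschitzWith (1 + (1 + ‖z‖₊) * ‖z.im‖₊⁻¹) T := by
    refine T.antilipschitz_of_bound fun p => ?_
    have hb := hA.abs_im_mul_norm_le p.2 z
    have hx : ‖(p : E × E).1‖ ≤ |z.im|⁻¹ * ‖T p‖ := by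
      rw [hT, inv_mul_eq_div, le_div_iff₀ hpos, mul_comm]
      exact hb
    have hy : ‖(p : E × E).2‖ ≤ ‖T p‖ + ‖z‖ * ‖(p : E × E).1‖ := by
      rw [hT, ← norm_smul]
      exact norm_le_norm_sub_add _ _
    have hc : 0 ≤ |z.im|⁻¹ * ‖T p‖ := by positivity
    push_cast
    rw [Real.norm_eq_abs]
    refine max_le ?_ ?_
    · change ‖(p : E × E).1‖ ≤ _
      nlinarith [norm_nonneg z, norm_nonneg (T p), mul_nonneg (norm_nonneg z) hc]
    · change ‖(p : E × E).2‖ ≤ _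
      nlinarith [mul_le_mul_of_nonneg_left hx (norm_nonneg z), norm_nonneg (T p)]
  have hrange : IsClosed (Set.range T) := hanti.isClosed_range T.uniformContinuous
  -- a vector orthogonal to the range is an eigenvector for the nonreal eigenvalue `z̄`
  have horth : (LinearMap.range (T : A.graph →ₗ[ℂ] E))ᗮ = ⊥ := by
    rw [Submodule.eq_bot_iff]
    intro v hv
    rw [Submodule.mem_orthogonal] at hv
    have hvg : (v, starRingEnd ℂ z • v) ∈ A.graph := by
      refine (hA.mem_graph_iff _).2 fun x y hxy => ?_
      have h := hv _ ⟨⟨(x, y), hxy⟩, rfl⟩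
      change inner ℂ (y - z • x) v = 0 at h
      rw [inner_sub_left, inner_smul_left, sub_eq_zero] at h
      rw [h, inner_smul_right]
    have h := hA.abs_im_mul_norm_le hvg (starRingEnd ℂ z)
    rw [sub_self, norm_zero, Complex.conj_im, abs_neg] at h
    exact norm_le_zero_iff.1 (le_of_mul_le_mul_left (by simpa using h) hpos)
  have : CompleteSpace (LinearMap.range (T : A.graph →ₗ[ℂ] E)) := by
    refine IsClosed.completeSpace_coe (hs := ?_)
    rw [LinearMap.coe_range]
    exact hrange
  rw [Submodule.orthogonal_eq_bot_iff] at horth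
  obtain ⟨p, hp⟩ : g ∈ LinearMap.range (T : A.graph →ₗ[ℂ] E) := horth ▸ Submodule.mem_top
  exact ⟨_, _, p.2, hp⟩

end SelfAdjoint

namespace DiracExpr

/-! ### The solutions `Φ(z)`, `Θ(z)` and `Ψ(z)` -/

section LimitSolutions

variable {D : DiracExpr} {x₀ : ℝ} {cs sn : ℂ → ℝ → C2} {lam0 : ℝ} {Φ₀ Θ₀ : ℝ → C2}

theorem IsFundamentalSystem.isSolution_limitSolution (hcs : D.IsFundamentalSystem x₀ cs sn)
    (u₀ : ℝ → C2) (z : ℂ) : D.IsSolution z (D.limitSolution cs sn u₀ z) := by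
  have h := (hcs z).2.2.2.1.combination (hcs z).1 (D.wronskianA (cs z) u₀)
    (-D.wronskianA (sn z) u₀)
  simp only [neg_smul, ← sub_eq_add_neg] at h
  exact h

theorem IsFundamentalSystem.isSolution_Psi (hcs : D.IsFundamentalSystem x₀ cs sn)
    (Φ₀ Θ₀ : ℝ → C2) (z w : ℂ) : D.IsSolution z (D.Psi cs sn Φ₀ Θ₀ z w) := by
  have h := (hcs.isSolution_limitSolution Θ₀ z).combination
    (hcs.isSolution_limitSolution Φ₀ z) 1 w
  simp only [one_smul] at h
  exact h

theorem wronskian_limitSolution_left (u₀ g : ℝ → C2) (z : ℂ) (x : ℝ) :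
    wronskian (D.limitSolution cs sn u₀ z) g x =
      D.wronskianA (cs z) u₀ * wronskian (sn z) g x -
        D.wronskianA (sn z) u₀ * wronskian (cs z) g x := by
  simp [wronskian, limitSolution]; ring

theorem LimitHypothesis.tendsto_wronskianA (hlim : D.LimitHypothesis lam0 Φ₀ Θ₀) {z : ℂ}
    {u : ℝ → C2} (hu : D.IsSolution z u) :
    Tendsto (wronskian u Θ₀) D.atA (𝓝 (D.wronskianA u Θ₀)) ∧
      Tendsto (wronskian u Φ₀) D.atA (𝓝 (D.wronskianA u Φ₀)) :=
  ⟨tendsto_nhds_limUnder (hlim.exists_tendsto hu).1,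
    tendsto_nhds_limUnder (hlim.exists_tendsto hu).2⟩

/-- The limits defining `Φ(z)` and `Θ(z)` satisfy the Plücker relation of `c`, `s`, `Θ₀`, `Φ₀`. -/
theorem wronskianA_det (hx₀ : x₀ ∈ D.I) (hcs : D.IsFundamentalSystem x₀ cs sn)
    (hlim : D.LimitHypothesis lam0 Φ₀ Θ₀) (z : ℂ) :
    D.wronskianA (cs z) Θ₀ * D.wronskianA (sn z) Φ₀ -
      D.wronskianA (cs z) Φ₀ * D.wronskianA (sn z) Θ₀ = 1 := by
  have hc := hlim.tendsto_wronskianA (hcs z).1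
  have hs := hlim.tendsto_wronskianA (hcs z).2.2.2.1
  refine tendsto_nhds_unique (hlim.tendsto_wronskian hc.1 hc.2 hs.1 hs.2)
    (tendsto_const_nhds.congr' ?_)
  filter_upwards [D.eventually_mem_atA] with x hx
  rw [hcs.wronskian_eq_one hx₀ z hx]

/-- `Θ(z)` and `Φ(z)` form a fundamental system, normalized like `Θ₀` and `Φ₀`. -/
theorem wronskian_limitSolution (hx₀ : x₀ ∈ D.I) (hcs : D.IsFundamentalSystem x₀ cs sn)
    (hlim : D.LimitHypothesis lam0 Φ₀ Θ₀) (z : ℂ) {x : ℝ} (hx : x ∈ D.I) :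
    wronskian (D.limitSolution cs sn Θ₀ z) (D.limitSolution cs sn Φ₀ z) x = 1 := by
  have h1 := wronskianA_det hx₀ hcs hlim z
  have h2 := hcs.wronskian_eq_one hx₀ z hx
  rw [← mul_one (1 : ℂ)]
  nth_rewrite 1 [← h1]
  rw [← h2]
  simp only [wronskian, limitSolution, PiLp.sub_apply, PiLp.smul_apply, smul_eq_mul]
  ring

theorem tendsto_wronskian_limitSolution (hcs : D.IsFundamentalSystem x₀ cs sn)
    (hlim : D.LimitHypothesis lam0 Φ₀ Θ₀) (u₀ : ℝ → C2) (z : ℂ) :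
    Tendsto (wronskian (D.limitSolution cs sn u₀ z) Θ₀) D.atA
        (𝓝 (D.wronskianA (cs z) u₀ * D.wronskianA (sn z) Θ₀ -
          D.wronskianA (sn z) u₀ * D.wronskianA (cs z) Θ₀)) ∧
      Tendsto (wronskian (D.limitSolution cs sn u₀ z) Φ₀) D.atA
        (𝓝 (D.wronskianA (cs z) u₀ * D.wronskianA (sn z) Φ₀ -
          D.wronskianA (sn z) u₀ * D.wronskianA (cs z) Φ₀)) := by
  have hc := hlim.tendsto_wronskianA (hcs z).1
  have hs := hlim.tendsto_wronskianA (hcs z).2.2.2.1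
  exact ⟨((hs.1.const_mul _).sub (hc.1.const_mul _)).congr fun x =>
      (wronskian_limitSolution_left _ _ _ _).symm,
    ((hs.2.const_mul _).sub (hc.2.const_mul _)).congr fun x =>
      (wronskian_limitSolution_left _ _ _ _).symm⟩

/-- The boundary values of `Φ(z)` at `a` are those of `Φ₀`. -/
theorem tendsto_wronskian_Phi (hx₀ : x₀ ∈ D.I) (hcs : D.IsFundamentalSystem x₀ cs sn)
    (hlim : D.LimitHypothesis lam0 Φ₀ Θ₀) (z : ℂ) :
    Tendsto (wronskian (D.limitSolution cs sn Φ₀ z) Θ₀) D.atA (𝓝 (-1)) ∧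
      Tendsto (wronskian (D.limitSolution cs sn Φ₀ z) Φ₀) D.atA (𝓝 0) := by
  have h := tendsto_wronskian_limitSolution hcs hlim Φ₀ z
  refine ⟨?_, ?_⟩
  · rw [← wronskianA_det hx₀ hcs hlim z]
    convert h.1 using 2
    ring
  · convert h.2 using 2
    ring

/-- The boundary values of `Ψ(z) = Θ(z) + w Φ(z)` at `a` are those of `Θ₀ + w Φ₀`. -/
theorem tendsto_wronskian_Psi (hx₀ : x₀ ∈ D.I) (hcs : D.IsFundamentalSystem x₀ cs sn)
    (hlim : D.LimitHypothesis lam0 Φ₀ Θ₀) (z w : ℂ) :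
    Tendsto (wronskian (D.Psi cs sn Φ₀ Θ₀ z w) Θ₀) D.atA (𝓝 (-w)) ∧
      Tendsto (wronskian (D.Psi cs sn Φ₀ Θ₀ z w) Φ₀) D.atA (𝓝 1) := by
  have h := tendsto_wronskian_limitSolution hcs hlim Θ₀ z
  have h' := tendsto_wronskian_Phi hx₀ hcs hlim z
  have e : ∀ g x, wronskian (D.limitSolution cs sn Θ₀ z) g x +
      w * wronskian (D.limitSolution cs sn Φ₀ z) g x = wronskian (D.Psi cs sn Φ₀ Θ₀ z w) g x := by
    intro g x
    simp only [wronskian, Psi, PiLp.add_apply, PiLp.smul_apply, smul_eq_mul]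
    ring
  refine ⟨?_, ?_⟩
  · convert (h.1.add (h'.1.const_mul w)).congr (e Θ₀) using 2
    ring
  · convert (h.2.add (h'.2.const_mul w)).congr (e Φ₀) using 2
    rw [mul_zero, add_zero, ← wronskianA_det hx₀ hcs hlim z]
    ring

theorem memLp_Psi (hx₀ : x₀ ∈ D.I) (hcs : D.IsFundamentalSystem x₀ cs sn)
    (hlim : D.LimitHypothesis lam0 Φ₀ Θ₀) {uplus : ℝ → C2} {z w : ℂ}
    (h : D.InDomainNearB uplus (D.Psi cs sn Φ₀ Θ₀ z w)) :
    MemLp (D.Psi cs sn Φ₀ Θ₀ z w) 2 D.vol := by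
  have hs := hcs.isSolution_Psi Φ₀ Θ₀ z w
  exact memLp_vol hs.1.continuousOn hx₀ (hlim.memLp_nearA hx₀ hcs hs hx₀) h.1

end LimitSolutions

/-! ### Vanishing of the boundary form at the right endpoint -/

section BoundaryForm

variable {D : DiracExpr} {uminus uplus : ℝ → C2}

/-- The domain of `H` in terms of functions: `g` may be any representative of `τ f`. -/
theorem mem_graph_H {f : ℝ → C2} (hf : D.ACloc f) (hf2 : MemLp f 2 D.vol) {g : ℝ → C2}
    (hfg : g =ᵐ[D.vol] D.tau f) (hg2 : MemLp g 2 D.vol)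
    (ha : Tendsto (wronskian uminus f) D.atA (𝓝 0)) (hb : Tendsto (wronskian uplus f) D.atB (𝓝 0)) :
    (hf2.toLp f, hg2.toLp g) ∈ (D.H uminus uplus).graph := by
  rw [graph_H]
  exact ⟨f, hf, hf2.coeFn_toLp, hg2.coeFn_toLp.trans hfg, ha, hb⟩

theorem integrable_inner_of_memLp {f g : ℝ → C2} (hf : MemLp f 2 D.vol) (hg : MemLp g 2 D.vol) :
    Integrable (fun x => inner ℂ (f x) (g x)) D.vol ∧
      inner ℂ (hf.toLp f) (hg.toLp g) = ∫ x, inner ℂ (f x) (g x) ∂D.vol := by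
  have h : (fun x => inner ℂ (hf.toLp f x) (hg.toLp g x)) =ᵐ[D.vol]
      fun x => inner ℂ (f x) (g x) := by
    filter_upwards [hf.coeFn_toLp, hg.coeFn_toLp] with x h1 h2
    rw [h1, h2]
  exact ⟨(L2.integrable_inner _ _).congr h, (L2.inner_def _ _).trans (integral_congr_ae h)⟩

/-- A smooth cutoff function: `0` to the left of `p` and `1` to the right of `q`. -/
def cutoff (p q : ℝ) (x : ℝ) : ℝ := Real.smoothTransition ((x - p) / (q - p))

theorem contDiff_cutoff (p q : ℝ) : ContDiff ℝ 1 (cutoff p q) :=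
  Real.smoothTransition.contDiff.comp ((contDiff_id.sub contDiff_const).div_const _)

theorem cutoff_of_le {p q x : ℝ} (hpq : p < q) (hx : x ≤ p) : cutoff p q x = 0 :=
  Real.smoothTransition.zero_of_nonpos
    (div_nonpos_of_nonpos_of_nonneg (sub_nonpos.2 hx) (sub_pos.2 hpq).le)

theorem cutoff_of_ge {p q x : ℝ} (hpq : p < q) (hx : q ≤ x) : cutoff p q x = 1 :=
  Real.smoothTransition.one_of_one_le ((one_le_div (sub_pos.2 hpq)).2 (by linarith))

theorem deriv_cutoff_of_notMem {p q x : ℝ} (hpq : p < q) (hx : x ∉ Set.Icc p q) :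
    deriv (cutoff p q) x = 0 := by
  rw [Set.mem_Icc, not_and_or, not_le, not_le] at hx
  rcases hx with hx | hx
  · have : cutoff p q =ᶠ[𝓝 x] fun _ => 0 := by
      filter_upwards [Iio_mem_nhds hx] with y hy using cutoff_of_le hpq hy.le
    rw [this.deriv_eq, deriv_const]
  · have : cutoff p q =ᶠ[𝓝 x] fun _ => 1 := by
      filter_upwards [Ioi_mem_nhds hx] with y hy using cutoff_of_ge hpq hy.le
    rw [this.deriv_eq, deriv_const]

theorem exists_abs_deriv_cutoff_le {p q : ℝ} (hpq : p < q) :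
    ∃ C, ∀ x, |deriv (cutoff p q) x| ≤ C := by
  obtain ⟨C, hC⟩ := isCompact_Icc.exists_bound_of_continuousOn (s := Set.Icc p q)
    ((contDiff_cutoff p q).continuous_deriv le_rfl).continuousOn
  refine ⟨C, fun x => ?_⟩
  by_cases hx : x ∈ Set.Icc p q
  · exact hC x hx
  · rw [deriv_cutoff_of_notMem hpq hx, abs_zero]
    exact (norm_nonneg _).trans (hC p ⟨le_rfl, hpq.le⟩)

/-- The rotation `(1/i) σ₂` applied to a vector of `ℂ²`. -/
def rot (v : C2) : C2 := !₂[-v 1, v 0]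

theorem norm_rot (v : C2) : ‖rot v‖ = ‖v‖ := by
  simp [EuclideanSpace.norm_eq, rot, add_comm]

theorem continuous_rot : Continuous rot := by
  unfold rot
  fun_prop

theorem tau_cutoff_smul {u : ℝ → C2} {x : ℝ} (hu : DifferentiableAt ℝ u x) (p q : ℝ) :
    D.tau (fun y => cutoff p q y • u y) x =
      cutoff p q x • D.tau u x + deriv (cutoff p q) x • rot (u x) := by
  have hχ : DifferentiableAt ℝ (cutoff p q) x :=
    (contDiff_cutoff p q).differentiable one_ne_zero x
  have hd : deriv (fun y => cutoff p q y • u y) x =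
      cutoff p q x • deriv u x + deriv (cutoff p q) x • u x :=
    (hχ.hasDerivAt.smul hu.hasDerivAt).deriv
  ext i
  fin_cases i
  · simp [tau_zero, hd, rot]; ring
  · simp [tau_one, hd, rot]; ring

/-- A solution that satisfies the conditions at `b` lies in the domain of `H` after it is cut off
near `a`. -/
theorem exists_mem_graph_of_inDomainNearB {z : ℂ} {u : ℝ → C2} (hu : D.IsSolution z u)
    (hub : D.InDomainNearB uplus u) {p q : ℝ} (hp : p ∈ D.I) (hq : q ∈ D.I) (hpq : p < q) :
    D.ACloc (fun x => cutoff p q x • u x) ∧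
    ∃ (g : ℝ → C2) (hf2 : MemLp (fun x => cutoff p q x • u x) 2 D.vol) (hg2 : MemLp g 2 D.vol),
      g =ᵐ[D.vol] D.tau (fun x => cutoff p q x • u x) ∧
      (hf2.toLp _, hg2.toLp g) ∈ (D.H uminus uplus).graph := by
  have hχ := contDiff_cutoff p q
  have hac : D.ACloc (fun x => cutoff p q x • u x) := fun s hs t ht =>
    (hχ.contDiffOn.absolutelyContinuousOnInterval).smul (hu.1 s hs t ht)
  have hu2 : MemLp ((D.nearB p).indicator u) 2 D.vol := by
    rw [memLp_indicator_iff_restrict (D.measurableSet_nearB p), vol,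
      Measure.restrict_restrict (D.measurableSet_nearB p),
      Set.inter_eq_left.2 (nearB_subset_I hp)]
    exact hub.1 p hp
  have hout : ∀ x ∈ D.I, x ∉ D.nearB p → x ≤ p := fun x hx hxp => by
    by_contra h
    exact hxp ⟨not_le.1 h, hx.2⟩
  have hmeas : ∀ {f : ℝ → C2}, ContinuousOn f D.I → AEStronglyMeasurable f D.vol :=
    fun hf => hf.aestronglyMeasurable D.measurableSet_I
  have huc := hu.1.continuousOn
  have hf2 : MemLp (fun x => cutoff p q x • u x) 2 D.vol := by
    refine MemLp.of_le hu2 (hmeas hac.continuousOn) ?_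
    filter_upwards [ae_restrict_mem D.measurableSet_I] with x hx
    by_cases hxp : x ∈ D.nearB p
    · rw [Set.indicator_of_mem hxp, norm_smul, cutoff,
        Real.norm_of_nonneg (Real.smoothTransition.nonneg _)]
      exact mul_le_of_le_one_left (norm_nonneg _) (Real.smoothTransition.le_one _)
    · rw [cutoff_of_le hpq (hout x hx hxp)]
      simp
  obtain ⟨C, hC⟩ := exists_abs_deriv_cutoff_le hpq
  have hr2 : MemLp (fun x => deriv (cutoff p q) x • rot (u x)) 2 D.vol := by
    refine MemLp.of_le_mul (c := C) hu2 (hmeas ((hχ.continuous_deriv le_rfl).continuousOn.smul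
      (continuous_rot.comp_continuousOn huc))) ?_
    filter_upwards [ae_restrict_mem D.measurableSet_I, ae_restrict_of_ae (volume.ae_ne p)]
      with x hx hne
    by_cases hxp : x ∈ D.nearB p
    · rw [Set.indicator_of_mem hxp, norm_smul, norm_rot]
      exact mul_le_mul_of_nonneg_right (hC x) (norm_nonneg _)
    · rw [deriv_cutoff_of_notMem hpq
        fun h => hne (le_antisymm (hout x hx hxp) h.1)]
      simp [Set.indicator_of_notMem hxp]
  have hg2 := (hf2.const_smul z).add hr2
  have hfg : (z • (fun x => cutoff p q x • u x) + fun x => deriv (cutoff p q) x • rot (u x))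
      =ᵐ[D.vol] D.tau (fun x => cutoff p q x • u x) := by
    filter_upwards [hu.2, hu.1.ae_differentiableAt] with x h1 h2
    rw [tau_cutoff_smul h2, h1]
    simp only [Pi.add_apply, Pi.smul_apply]
    rw [smul_comm]
  refine ⟨hac, _, hf2, hg2, hfg, mem_graph_H hac hf2 hfg hg2 ?_ ?_⟩
  · refine tendsto_const_nhds.congr' ?_
    filter_upwards [eventually_atA hp] with x hx
    simp [wronskian, cutoff_of_le hpq hx.2.le]
  · refine hub.2.congr' ?_
    filter_upwards [eventually_atB hq] with x hx
    simp [wronskian, cutoff_of_ge hpq hx.2.le]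

/-- The boundary form at `b` vanishes on solutions that satisfy the conditions of `H` there. This
holds in the limit circle and in the limit point case, and for any `uplus`: after a cutoff near `a`
it is the symmetry of `H`. -/
theorem tendsto_wronskian_atB (hH : IsSelfAdjoint (D.H uminus uplus)) {z z' : ℂ} {f g : ℝ → C2}
    (hf : D.IsSolution z f) (hfb : D.InDomainNearB uplus f) (hg : D.IsSolution z' g)
    (hgb : D.InDomainNearB uplus g) : Tendsto (wronskian (conjC f) g) D.atB (𝓝 0) := by
  obtain ⟨c, hc⟩ := D.eventually_mem_atA.exists
  obtain ⟨q, hq, hcq⟩ := exists_gt_mem_I hc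
  obtain ⟨hF, F', hF2, hF'2, hFF', hFg⟩ :=
    exists_mem_graph_of_inDomainNearB (uminus := uminus) hf hfb hc hq hcq
  obtain ⟨hG, G', hG2, hG'2, hGG', hGg⟩ :=
    exists_mem_graph_of_inDomainNearB (uminus := uminus) hg hgb hc hq hcq
  set F := fun x => cutoff c q x • f x with hFdef
  set G := fun x => cutoff c q x • g x with hGdef
  have hsymm := (hH.mem_graph_iff _).1 hGg _ _ hFg
  obtain ⟨i1, e1⟩ := integrable_inner_of_memLp hF'2 hG2
  obtain ⟨i2, e2⟩ := integrable_inner_of_memLp hF2 hG'2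
  have hlag := tendsto_wronskian_sub hF.conj hG
    (h := fun x => inner ℂ (F' x) (G x) - inner ℂ (F x) (G' x)) (by
      filter_upwards [hFF', hGG', hF.ae_differentiableAt] with x h1 h2 h3
      rw [← dotC_conjC, ← dotC_conjC, h2]
      congr 2
      ext i
      rw [tau_conjC h3, conjC_apply, h1]) (i1.sub i2)
  rw [integral_sub i1 i2, ← e1, ← e2, hsymm, sub_self] at hlag
  -- near `a` the cut-off functions vanish, near `b` they are `f` and `g`
  have hlag' : Tendsto (fun p : ℝ × ℝ => wronskian (conjC f) g p.2) (D.atA ×ˢ D.atB) (𝓝 0) := by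
    refine hlag.congr' ?_
    filter_upwards [(eventually_atA hc).prod_inl _, (eventually_atB hq).prod_inr _] with p h1 h2
    simp [wronskian, hFdef, hGdef, cutoff_of_le hcq h1.2.le, cutoff_of_ge hcq h2.2.le]
  have := (tendsto_map'_iff (f := wronskian (conjC f) g) (g := Prod.snd)
    (x := D.atA ×ˢ D.atB)).2 hlag'
  rwa [map_snd_prod] at this

end BoundaryForm

/-! ### The Weyl solutions -/

section Weyl

variable {D : DiracExpr} {x₀ : ℝ} {cs sn : ℂ → ℝ → C2} {lam0 : ℝ} {Φ₀ Θ₀ uplus : ℝ → C2}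

theorem tendsto_wronskian_conjC {u u₀ : ℝ → C2} (hu₀ : D.IsRealValued u₀) {l : ℂ}
    (h : Tendsto (wronskian u u₀) D.atA (𝓝 l)) :
    Tendsto (wronskian (conjC u) u₀) D.atA (𝓝 (starRingEnd ℂ l)) := by
  refine ((Complex.continuous_conj.tendsto l).comp h).congr' ?_
  filter_upwards [D.eventually_mem_atA] with x hx
  rw [Function.comp_apply, ← wronskian_conjC]
  refine wronskian_congr_right ?_
  ext i
  exact Complex.conj_eq_iff_im.2 (hu₀ x hx i)

/-- The identity behind all properties of the Weyl function: the Lagrange identity for `Ψ(z)̄` and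
`Ψ(z')`, whose boundary form is `w' - w̄` at `a` and vanishes at `b`. -/
theorem sub_conj_eq_mul_integral_inner (hx₀ : x₀ ∈ D.I) (hcs : D.IsFundamentalSystem x₀ cs sn)
    (hlim : D.LimitHypothesis lam0 Φ₀ Θ₀) (hH : IsSelfAdjoint (D.H Φ₀ uplus)) {z w z' w' : ℂ}
    (h : D.InDomainNearB uplus (D.Psi cs sn Φ₀ Θ₀ z w))
    (h' : D.InDomainNearB uplus (D.Psi cs sn Φ₀ Θ₀ z' w')) :
    w' - starRingEnd ℂ w = (z' - starRingEnd ℂ z) *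
      ∫ x, inner ℂ (D.Psi cs sn Φ₀ Θ₀ z w x) (D.Psi cs sn Φ₀ Θ₀ z' w' x) ∂D.vol := by
  have hf := hcs.isSolution_Psi Φ₀ Θ₀ z w
  have hg := hcs.isSolution_Psi Φ₀ Θ₀ z' w'
  have hfa := tendsto_wronskian_Psi hx₀ hcs hlim z w
  have hga := tendsto_wronskian_Psi hx₀ hcs hlim z' w'
  have hf2 := memLp_Psi hx₀ hcs hlim h
  have hg2 := memLp_Psi hx₀ hcs hlim h'
  set f := D.Psi cs sn Φ₀ Θ₀ z w
  set g := D.Psi cs sn Φ₀ Θ₀ z' w'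
  have hb := tendsto_wronskian_atB hH hf h hg h'
  have ha := hlim.tendsto_wronskian (tendsto_wronskian_conjC hlim.2.2.2.1 hfa.1)
    (tendsto_wronskian_conjC hlim.2.2.1 hfa.2) hga.1 hga.2
  have hlag := tendsto_wronskian_sub hf.1.conj hg.1
    (h := fun x => (starRingEnd ℂ z - z') * inner ℂ (f x) (g x)) (by
      filter_upwards [hf.conj.2, hg.2] with x h1 h2
      rw [h1, h2, dotC_smul_left, dotC_smul_right, dotC_conjC]
      ring) ((integrable_inner_of_memLp hf2 hg2).1.const_mul _)
  have key := tendsto_nhds_unique hlag ((hb.comp tendsto_snd).sub (ha.comp tendsto_fst))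
  rw [integral_const_mul, map_neg, map_one] at key
  linear_combination key

/-- For nonreal `z`, solving `(H - z) u = g` with `g` the conjugate of `Φ(z)` on a compact interval
and `0` elsewhere produces the Weyl solution: `W(u, Φ(z))` vanishes to the left of the interval,
and hence it is a positive constant `K` to the right, where `u = K Θ(z) + B Φ(z)`. -/
theorem exists_inDomainNearB (hx₀ : x₀ ∈ D.I) (hcs : D.IsFundamentalSystem x₀ cs sn)
    (hlim : D.LimitHypothesis lam0 Φ₀ Θ₀) (hH : IsSelfAdjoint (D.H Φ₀ uplus)) {z : ℂ}
    (hz : z.im ≠ 0) : ∃ w, D.InDomainNearB uplus (D.Psi cs sn Φ₀ Θ₀ z w) := by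
  set Φ := D.limitSolution cs sn Φ₀ z with hΦdef
  set Θ := D.limitSolution cs sn Θ₀ z with hΘdef
  have hΦ : D.IsSolution z Φ := hcs.isSolution_limitSolution Φ₀ z
  have hΘ : D.IsSolution z Θ := hcs.isSolution_limitSolution Θ₀ z
  have hW : ∀ x ∈ D.I, wronskian Θ Φ x = 1 := fun x hx => wronskian_limitSolution hx₀ hcs hlim z hx
  have hΦc := hΦ.1.continuousOn
  obtain ⟨d, hd, hcd⟩ := exists_gt_mem_I hx₀
  -- the right-hand side
  set g : ℝ → C2 := (Set.Icc x₀ d).indicator (conjC Φ) with hgdef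
  have hg2 : MemLp g 2 D.vol := by
    have hsub := Icc_subset_I hx₀ hd
    have hc := hΦ.1.conj.continuousOn
    rw [hgdef, memLp_indicator_iff_restrict measurableSet_Icc, vol,
      Measure.restrict_restrict measurableSet_Icc, Set.inter_eq_left.2 hsub,
      memLp_iff_of_continuousOn hc measurableSet_Icc hsub]
    exact integrableOn_Icc_sq hc hx₀ hd
  obtain ⟨U, V, hUV, hVU⟩ := hH.exists_mem_graph_sub_smul_eq hz (hg2.toLp g)
  rw [graph_H] at hUV
  obtain ⟨u, hu, hUu, hVu, hua, hub⟩ := hUV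
  have hug : ∀ᵐ x ∂D.vol, D.tau u x = z • u x + g x := by
    have h1 : V = z • U + hg2.toLp g := by rw [← hVU]; abel
    have h2 : (V : ℝ → C2) =ᵐ[D.vol] fun x => z • u x + g x := by
      rw [h1]
      filter_upwards [Lp.coeFn_add (z • U) (hg2.toLp g), Lp.coeFn_smul z U, hUu,
        hg2.coeFn_toLp] with x e1 e2 e3 e4
      rw [e1, Pi.add_apply, e2, Pi.smul_apply, e3, e4]
    exact hVu.symm.trans h2
  -- Wronskians with solutions change only across the interval
  have hconst : ∀ {v : ℝ → C2}, D.IsSolution z v → ∀ s ∈ D.I, ∀ t ∈ D.I,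
      (∀ x ∈ Set.uIoc s t, x ∉ Set.Icc x₀ d) → wronskian u v t = wronskian u v s := by
    intro v hv s hs t ht hst
    have h := wronskian_sub_eq_integral hu hug hv hs ht
    rw [intervalIntegral.integral_congr_ae (g := fun _ => (0 : ℂ)) (ae_of_all _ fun x hx => by
      rw [hgdef, Set.indicator_of_notMem (hst x hx)]; simp [dotC]),
      intervalIntegral.integral_zero] at h
    exact sub_eq_zero.1 h.symm
  have hexp : ∀ x ∈ D.I, u x = wronskian u Φ x • Θ x + wronskian Θ u x • Φ x := fun x hx => by
    rw [← wronskian_smul, hW x hx, one_smul]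
  -- `u` is a multiple of `Φ(z)` near `a`
  obtain ⟨p, hp, hpx⟩ := exists_lt_mem_I hx₀
  have hleft : wronskian u Φ p = 0 := by
    have hnear : ∀ᶠ x in D.atA, x ∈ D.I ∧ wronskian u Φ x = wronskian u Φ p ∧
        wronskian Θ u x = wronskian Θ u p := by
      filter_upwards [eventually_atA hp] with x hx
      have hnot : ∀ y ∈ Set.uIoc p x, y ∉ Set.Icc x₀ d := fun y hy hy' => by
        rw [Set.uIoc_of_ge hx.2.le] at hy
        exact absurd hy'.1 (not_le.2 (hy.2.trans_lt hpx))
      refine ⟨hx.1, hconst hΦ p hp x hx.1 hnot, ?_⟩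
      rw [wronskian_antisymm Θ u x, hconst hΘ p hp x hx.1 hnot, ← wronskian_antisymm]
    have hΘa := tendsto_wronskian_Psi hx₀ hcs hlim z 0
    have hΘe : D.Psi cs sn Φ₀ Θ₀ z 0 = Θ := by funext x; simp [Psi, hΘdef]
    rw [hΘe] at hΘa
    have hΦa := tendsto_wronskian_Phi hx₀ hcs hlim z
    have hlim1 : Tendsto (wronskian u Φ₀) D.atA
        (𝓝 (wronskian u Φ p * 1 + wronskian Θ u p * 0)) := by
      refine ((hΘa.2.const_mul (wronskian u Φ p)).add
        (hΦa.2.const_mul (wronskian Θ u p))).congr' ?_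
      filter_upwards [hnear] with x ⟨hxI, h1, h2⟩
      have h3 := hexp x hxI
      rw [h1, h2] at h3
      rw [← wronskian_add_smul_left]
      exact wronskian_congr_left h3.symm
    have hlim2 : Tendsto (wronskian u Φ₀) D.atA (𝓝 0) := by
      have h := hua.neg
      rw [neg_zero] at h
      exact h.congr fun x => (wronskian_antisymm _ _ _).symm
    simpa using tendsto_nhds_unique hlim1 hlim2
  -- the value of `W(u, Φ(z))` to the right of the interval
  have hK : wronskian u Φ d = ((∫ x in x₀..d, ‖Φ x‖ ^ 2 : ℝ) : ℂ) := by
    have h0 : wronskian u Φ x₀ = 0 := by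
      rw [← hleft]
      refine sub_eq_zero.1 ?_
      rw [← wronskian_sub_eq_integral hu hug hΦ hp hx₀,
        intervalIntegral.integral_congr_ae (g := fun _ => (0 : ℂ)),
        intervalIntegral.integral_zero]
      filter_upwards [volume.ae_ne x₀] with x hne hx
      rw [Set.uIoc_of_le hpx.le] at hx
      rw [hgdef, Set.indicator_of_notMem fun h => hne (le_antisymm hx.2 h.1)]
      simp [dotC]
    rw [← sub_zero (wronskian u Φ d), ← h0, ← wronskian_sub_eq_integral hu hug hΦ hx₀ hd,
      ← intervalIntegral.integral_ofReal]
    refine intervalIntegral.integral_congr fun x hx => ?_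
    rw [Set.uIcc_of_le hcd.le] at hx
    simp only [hgdef, Set.indicator_of_mem hx, dotC_conjC_self]
  have hKpos : 0 < ∫ x in x₀..d, ‖Φ x‖ ^ 2 := by
    refine intervalIntegral.intervalIntegral_pos_of_pos_on ?_ (fun x hx => ?_) hcd
    · rw [intervalIntegrable_iff_integrableOn_Icc_of_le hcd.le]
      exact integrableOn_Icc_sq hΦc hx₀ hd
    · have hxI := Icc_subset_I hx₀ hd (Set.Ioo_subset_Icc_self hx)
      refine pow_pos (norm_pos_iff.2 fun h => ?_) 2
      have := hW x hxI
      simp [wronskian, h] at this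
  set K := wronskian u Φ d with hKdef
  have hK0 : K ≠ 0 := by rw [hK]; exact_mod_cast hKpos.ne'
  -- to the right of the interval, `u` is a multiple of `Ψ(z)`
  set w := K⁻¹ * wronskian Θ u d with hw
  have hright : ∀ x ∈ D.nearB d, D.Psi cs sn Φ₀ Θ₀ z w x = K⁻¹ • u x := by
    intro x hx
    have hxI := nearB_subset_I hd hx
    have hnot : ∀ y ∈ Set.uIoc d x, y ∉ Set.Icc x₀ d := fun y hy hy' => by
      rw [Set.uIoc_of_le hx.1.le] at hy
      exact absurd hy'.2 (not_le.2 hy.1)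
    rw [hexp x hxI, hconst hΦ d hd x hxI hnot, wronskian_antisymm Θ u x,
      hconst hΘ d hd x hxI hnot, ← wronskian_antisymm, smul_add, smul_smul, smul_smul,
      inv_mul_cancel₀ hK0, one_smul]
    rfl
  have hΨ := hcs.isSolution_Psi Φ₀ Θ₀ z w
  refine ⟨w, l2NearB_of_nearB hΨ.1.continuousOn hd ?_, ?_⟩
  · have hu2 : MemLp u 2 D.vol := (memLp_congr_ae hUu).1 (Lp.memLp U)
    refine ((hu2.mono_measure (Measure.restrict_mono_set volume (nearB_subset_I hd))).const_smul
      K⁻¹).ae_eq ?_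
    filter_upwards [ae_restrict_mem (D.measurableSet_nearB d)] with x hx
    rw [hright x hx, Pi.smul_apply]
  · have h := hub.const_mul K⁻¹
    rw [mul_zero] at h
    refine h.congr' ?_
    filter_upwards [eventually_atB hd] with x hx
    have := hright x ⟨hx.2, hx.1.2⟩
    simp only [wronskian, this, PiLp.smul_apply, smul_eq_mul]
    ring

/-- The Weyl solutions are locally Lipschitz continuous in `L²` as functions of `z`. -/
theorem abs_im_mul_norm_toLp_sub_le (hx₀ : x₀ ∈ D.I) (hcs : D.IsFundamentalSystem x₀ cs sn)
    (hlim : D.LimitHypothesis lam0 Φ₀ Θ₀) (hH : IsSelfAdjoint (D.H Φ₀ uplus)) {z w z' w' : ℂ}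
    (h : D.InDomainNearB uplus (D.Psi cs sn Φ₀ Θ₀ z w))
    (h' : D.InDomainNearB uplus (D.Psi cs sn Φ₀ Θ₀ z' w')) :
    |z'.im| * ‖(memLp_Psi hx₀ hcs hlim h').toLp _ - (memLp_Psi hx₀ hcs hlim h).toLp _‖ ≤
      ‖z' - z‖ * ‖(memLp_Psi hx₀ hcs hlim h).toLp _‖ := by
  have hf := hcs.isSolution_Psi Φ₀ Θ₀ z w
  have hg := hcs.isSolution_Psi Φ₀ Θ₀ z' w'
  have hfa := (tendsto_wronskian_Psi hx₀ hcs hlim z w).2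
  have hga := (tendsto_wronskian_Psi hx₀ hcs hlim z' w').2
  have hf2 := memLp_Psi hx₀ hcs hlim h
  have hg2 := memLp_Psi hx₀ hcs hlim h'
  set f := D.Psi cs sn Φ₀ Θ₀ z w
  set g := D.Psi cs sn Φ₀ Θ₀ z' w'
  have hsub : g - f = g + (-1 : ℂ) • f := by rw [neg_one_smul, sub_eq_add_neg]
  have hac : D.ACloc (g - f) := hsub ▸ hg.1.add (hf.1.smul (-1))
  have htau : (z' • g - z • f) =ᵐ[D.vol] D.tau (g - f) := by
    filter_upwards [hf.2, hg.2, hf.1.ae_differentiableAt, hg.1.ae_differentiableAt]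
      with x h1 h2 h3 h4
    rw [hsub, tau_add h4 (h3.const_smul _), tau_smul _ h3, h1, h2]
    simp [sub_eq_add_neg]
  have hmem := mem_graph_H (uminus := Φ₀) (uplus := uplus) hac (hg2.sub hf2) htau
    ((hg2.const_smul z').sub (hf2.const_smul z)) (by
      have h1 := hfa.sub hga
      rw [sub_self] at h1
      refine h1.congr fun x => ?_
      rw [wronskian_antisymm f, wronskian_antisymm g]
      refine Eq.trans ?_ (wronskian_sub_right Φ₀ g f x).symm
      ring) (by
      have h1 := h'.2.sub h.2
      rw [sub_zero] at h1
      exact h1.congr fun x => (wronskian_sub_right uplus g f x).symm)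
  refine (hH.abs_im_mul_norm_le hmem z').trans (le_of_eq ?_)
  rw [← norm_smul, MemLp.toLp_sub hg2 hf2, MemLp.toLp_sub (hg2.const_smul z')
    (hf2.const_smul z), MemLp.toLp_const_smul _ hg2, MemLp.toLp_const_smul _ hf2]
  congr 1
  module

end Weyl

end DiracExpr

end

/-! ### The singular Weyl function -/

theorem theorem4p2 (D : DiracExpr) (x₀ : ℝ) (hx₀ : x₀ ∈ D.I)
    (cs sn : ℂ → ℝ → C2) (hcs : D.IsFundamentalSystem x₀ cs sn)
    (lam0 : ℝ) (Φ₀ Θ₀ : ℝ → C2) (hlim : D.LimitHypothesis lam0 Φ₀ Θ₀)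
    (uplus : ℝ → C2) (hu : D.IsBoundaryFunctionAtB uplus)
    (hH : IsSelfAdjoint (D.H Φ₀ uplus)) :
    (∀ z : ℂ, z.im ≠ 0 → ∃! w : ℂ, D.InDomainNearB uplus (D.Psi cs sn Φ₀ Θ₀ z w)) ∧
    ∀ M : ℂ → ℂ,
      (∀ z : ℂ, z.im ≠ 0 → D.InDomainNearB uplus (D.Psi cs sn Φ₀ Θ₀ z (M z))) →
      IsHerglotzNevanlinna M ∧
      ∀ z : ℂ, D.InDomainNearB uplus (D.Psi cs sn Φ₀ Θ₀ z (M z)) →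
        IntegrableOn (fun x => ‖D.Psi cs sn Φ₀ Θ₀ z (M z) x‖ ^ 2) D.I volume ∧
        (M z).im = z.im * ∫ x in D.I, ‖D.Psi cs sn Φ₀ Θ₀ z (M z) x‖ ^ 2 := by
  have pair := fun {z w z' w' : ℂ} => D.sub_conj_eq_mul_integral_inner (z := z) (w := w) (z' := z')
    (w' := w') hx₀ hcs hlim hH
  have conj_eq : ∀ {z w w' : ℂ}, D.InDomainNearB uplus (D.Psi cs sn Φ₀ Θ₀ z w) →
      D.InDomainNearB uplus (D.Psi cs sn Φ₀ Θ₀ (starRingEnd ℂ z) w') → w' = starRingEnd ℂ w := by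
    intro z w w' h h'
    have := pair h h'
    rwa [sub_self, zero_mul, sub_eq_zero] at this
  have conj_im : ∀ {z : ℂ}, z.im ≠ 0 → (starRingEnd ℂ z).im ≠ 0 := fun h => by simpa using h
  refine ⟨fun z hz => ?_, fun M hM => ?_⟩
  · obtain ⟨w, hw⟩ := D.exists_inDomainNearB hx₀ hcs hlim hH hz
    obtain ⟨v, hv⟩ := D.exists_inDomainNearB hx₀ hcs hlim hH (conj_im hz)
    refine ⟨w, hw, fun w' hw' => ?_⟩
    -- both `w` and `w'` are the conjugate of the value at the conjugate point
    exact (starRingEnd ℂ).injective ((conj_eq hw' hv).symm.trans (conj_eq hw hv))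
  have hsymm : ∀ z : ℂ, z.im ≠ 0 → M (starRingEnd ℂ z) = starRingEnd ℂ (M z) := fun z hz =>
    conj_eq (hM z hz) (hM _ (conj_im hz))
  have him : ∀ z : ℂ, D.InDomainNearB uplus (D.Psi cs sn Φ₀ Θ₀ z (M z)) →
      IntegrableOn (fun x => ‖D.Psi cs sn Φ₀ Θ₀ z (M z) x‖ ^ 2) D.I volume ∧
      (M z).im = z.im * ∫ x in D.I, ‖D.Psi cs sn Φ₀ Θ₀ z (M z) x‖ ^ 2 := by
    intro z hz
    have hc := (hcs.isSolution_Psi Φ₀ Θ₀ z (M z)).1.continuousOn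
    refine ⟨(DiracExpr.memLp_iff_of_continuousOn hc D.measurableSet_I subset_rfl).1
      (D.memLp_Psi hx₀ hcs hlim hz), ?_⟩
    have h := pair hz hz
    simp only [← dotC_conjC, dotC_conjC_self] at h
    rw [integral_complex_ofReal, Complex.sub_conj, Complex.sub_conj] at h
    have h' := congrArg Complex.im h
    simp only [Complex.mul_im, Complex.ofReal_re, Complex.ofReal_im, Complex.I_re, Complex.I_im,
      Complex.mul_re] at h'
    change _ = z.im * ∫ x, _ ∂D.vol
    simp only [mul_zero, mul_one, zero_add, add_zero] at h'
    linear_combination h' / 2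
  refine ⟨⟨fun z₀ hz₀ => ?_, hsymm, fun z hz => ?_⟩, him⟩
  · -- `M z - M z₀ = (z - z₀) ⟪Ψ(z̄₀), Ψ(z)⟫`, and `Ψ` is continuous with values in `L²`
    have hz₀' : z₀.im ≠ 0 := hz₀
    have hopen : ∀ᶠ z : ℂ in 𝓝 z₀, z.im ≠ 0 :=
      Complex.continuous_im.continuousAt.eventually_ne hz₀'
    let L : ∀ z : ℂ, z.im ≠ 0 → D.L2 := fun z hz => (D.memLp_Psi hx₀ hcs hlim (hM z hz)).toLp _
    let Ψ : ℂ → D.L2 := fun z => if hz : z.im ≠ 0 then L z hz else 0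
    have hΨ : ∀ z (hz : z.im ≠ 0), Ψ z = L z hz := fun z hz => dif_pos hz
    have hcont : Tendsto Ψ (𝓝 z₀) (𝓝 (Ψ z₀)) := by
      have hb : Tendsto (fun z : ℂ => ‖z - z₀‖ * ‖Ψ z₀‖ / |z.im|) (𝓝 z₀) (𝓝 0) := by
        have h : ContinuousAt (fun z : ℂ => ‖z - z₀‖ * ‖Ψ z₀‖ / |z.im|) z₀ := by
          refine ContinuousAt.div ?_ ?_ (abs_ne_zero.2 hz₀')
          · fun_prop
          · exact (Complex.continuous_im.abs).continuousAt
        simpa [ContinuousAt] using h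
      refine tendsto_iff_norm_sub_tendsto_zero.2 (squeeze_zero' (Eventually.of_forall fun _ =>
        norm_nonneg _) ?_ hb)
      filter_upwards [hopen] with z hz
      rw [le_div_iff₀ (abs_pos.2 hz), mul_comm, hΨ z hz, hΨ z₀ hz₀']
      exact D.abs_im_mul_norm_toLp_sub_le hx₀ hcs hlim hH (hM z₀ hz₀') (hM z hz)
    set z₁ := starRingEnd ℂ z₀ with hz₁def
    have hz₁ : z₁.im ≠ 0 := conj_im hz₀'
    have e1 : starRingEnd ℂ z₁ = z₀ := Complex.conj_conj z₀
    have e2 : starRingEnd ℂ (M z₁) = M z₀ := by rw [hz₁def, hsymm z₀ hz₀', Complex.conj_conj]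
    have hdiff : ∀ z : ℂ, z.im ≠ 0 → M z - M z₀ = (z - z₀) * inner ℂ (Ψ z₁) (Ψ z) := by
      intro z hz
      have h := pair (hM z₁ hz₁) (hM z hz)
      rw [← (D.integrable_inner_of_memLp (D.memLp_Psi hx₀ hcs hlim (hM z₁ hz₁))
        (D.memLp_Psi hx₀ hcs hlim (hM z hz))).2, e1, e2] at h
      rw [h, hΨ z₁ hz₁, hΨ z hz]
    have hderiv : HasDerivAt M (inner ℂ (Ψ z₁) (Ψ z₀)) z₀ := by
      rw [hasDerivAt_iff_tendsto_slope]
      refine ((tendsto_const_nhds.inner hcont).mono_left nhdsWithin_le_nhds).congr' ?_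
      filter_upwards [nhdsWithin_le_nhds hopen, self_mem_nhdsWithin] with z hz hne
      rw [slope_def_field, hdiff z hz, mul_div_cancel_left₀ _ (sub_ne_zero.2 hne)]
    exact hderiv.differentiableAt.differentiableWithinAt
  · rw [(him z (hM z hz.ne')).2]
    exact mul_nonneg hz.le (integral_nonneg fun x => sq_nonneg _)
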